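/- **Theorem 4.1.** Let $M$ be a complex manifold, $S\subset M$ a (not necessarily closed) complex submanifold of pure codimension $m$, and $k\ge 2$ an integer. Let $\mathcal O_M$ be the sheaf of germs of holomorphic functions on $M$, $\mathcal I_S\subset\mathcal O_M$ the ideal sheaf of $S$, and $\mathcal O_S=\mathcal O_M/\mathcal I_S$; all sheaves $\mathcal O_M/\mathcal I_S^{e}$ and $\mathcal I_S/\mathcal I_S^{e}$ below are regarded as sheaves on $S$. For $k\ge h\ge0$ let $\theta_{k,h}\colon\mathcal O_M/\mathcal I_S^{k+1}\to\mathcal O_M/\mathcal I_S^{h+1}$ be the canonical projection, and write $\theta_k=\theta_{k,0}$. * $S$ is *$k$-linearizable* if its $k$-th infinitesimal neighbourhood $S(k)=(S,\mathcal O_M/\mathcal I_S^{k+1})$ in $M$ is isomorphic to the $k$-th infinitesimal neighbourhood $S_N(k)=(S,\mathcal O_{N_S}/\mathcal I_{S,N}^{k+1})$ of the zero section, identified with $S$, of the normal bundle $N_S=TM|_S/TS$; that is, if there is an isomorphism of sheaves of rings $\psi\colon\mathcal O_{N_S}/\mathcal I_{S,N}^{k+1}\to\mathcal O_M/\mathcal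 I_S^{k+1}$ with $\theta_k\circ\psi=\theta_k^N$, where $\theta_k^N$ is the canonical projection of $\mathcal O_{N_S}/\mathcal I_{S,N}^{k+1}$ onto $\mathcal O_S$. * A *$k$-th order lifting* is a morphism of sheaves of rings $\rho\colon\mathcal O_S\to\mathcal O_M/\mathcal I_S^{k+1}$ with $\theta_k\circ\rho=\mathrm{id}$; $S$ is *$k$-split* if there is one. It induces the lifting $\theta_{k,h}\circ\rho$ of order $h$ for every $0\le h\le k$. * A $k$-th order lifting $\rho$ makes $\mathcal I_S/\mathcal I_S^{h+1}$, for $1\le h\le k+1$, into an $\mathcal O_S$-module: $\mathcal I_S/\mathcal I_S^{h+1}$ is an $\mathcal O_M/\mathcal I_S^{h}$-module, and one restricts scalars along $\theta_{k,h-1}\circ\rho\colon\mathcal O_S\to\mathcal O_M/\mathcal I_S^{h}$ (and $\mathcal I_S/\mathcal I_S=0$). * $S$ is *$k$-comfortably embedded with respect to* the $k$-th order lifting $\rho$ if for every $1\le h\le k+1$ the canonical projection $\mathcal I_S/\mathcal I_S^{h+1}\to\mathcal I_S/\mathcal I_S^{h}$ has a right inverse $\nu_{h-1,h}\colon\mathcal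 I_S/\mathcal I_S^{h}\to\mathcal I_S/\mathcal I_S^{h+1}$ which is a morphism of sheaves of $\mathcal O_S$-modules for these structures. Then $S$ is $k$-linearizable if and only if there is a $k$-th order lifting $\rho\colon\mathcal O_S\to\mathcal O_M/\mathcal I_S^{k+1}$ (that is, $S$ is $k$-split) such that $S$ is $(k-1)$-comfortably embedded with respect to the induced $(k-1)$-th order lifting $\theta_{k,k-1}\circ\rho$. -/

import Mathlib

open scoped Manifold ContDiff Topology
open Set Filter

noncomputable section

namespace CplxSub

/-! ## Germs of holomorphic functions and powers of the ideal of a subset -/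

section Stalks

variable (E : Type*) [NormedAddCommGroup E] [NormedSpace ℂ E]
  {X : Type*} [TopologicalSpace X] [ChartedSpace E X]

/-- The ring `𝓞_{X,x}` of germs at `x` of holomorphic functions on the complex manifold `X`. -/
def HolGerm (x : X) : Subring (Germ (𝓝 x) ℂ) where
  carrier := {g | ∃ f : X → ℂ, ContMDiffAt 𝓘(ℂ, E) 𝓘(ℂ) ω f x ∧ (f : Germ (𝓝 x) ℂ) = g}
  mul_mem' := by
    rintro _ _ ⟨f, hf, rfl⟩ ⟨g, hg, rfl⟩
    exact ⟨f * g, hf.mul hg, rfl⟩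
  one_mem' := ⟨1, contMDiffAt_const, rfl⟩
  add_mem' := by
    rintro _ _ ⟨f, hf, rfl⟩ ⟨g, hg, rfl⟩
    exact ⟨f + g, hf.add hg, rfl⟩
  zero_mem' := ⟨0, contMDiffAt_const, rfl⟩
  neg_mem' := by
    rintro _ ⟨f, hf, rfl⟩
    exact ⟨-f, hf.neg, rfl⟩

variable {E} in
/-- The germ at `x` of a function that is holomorphic near `x`. -/
def germAt {x : X} (f : X → ℂ) (hf : ContMDiffAt 𝓘(ℂ, E) 𝓘(ℂ) ω f x) : HolGerm E x :=
  ⟨f, f, hf, rfl⟩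

/-- The stalk at `x` of the ideal sheaf of a subset `Z`: the germs at `x` of holomorphic functions
that vanish on `Z` near `x`. -/
def vanIdeal (Z : Set X) (x : X) : Ideal (HolGerm E x) where
  carrier := {g | ∃ f : X → ℂ, (f : Germ (𝓝 x) ℂ) = g.1 ∧ ∀ᶠ y in 𝓝 x, y ∈ Z → f y = 0}
  add_mem' := by
    rintro a b ⟨f, hf, hf'⟩ ⟨g, hg, hg'⟩
    refine ⟨f + g, ?_, ?_⟩
    · simp [hf, hg]
    · filter_upwards [hf', hg'] with y h1 h2 hy
      simp [h1 hy, h2 hy]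
  zero_mem' := ⟨0, rfl, by simp⟩
  smul_mem' := by
    rintro ⟨_, c, hc, rfl⟩ a ⟨f, hf, hf'⟩
    refine ⟨c * f, ?_, ?_⟩
    · simp [hf]
    · filter_upwards [hf'] with y h1 hy
      simp [h1 hy]

theorem germAt_mem_vanIdeal {Z : Set X} {x : X} {f : X → ℂ}
    (hf : ContMDiffAt 𝓘(ℂ, E) 𝓘(ℂ) ω f x) :
    germAt f hf ∈ vanIdeal E Z x ↔ ∀ᶠ y in 𝓝 x, y ∈ Z → f y = 0 := by
  constructor
  · rintro ⟨g, hg, hg'⟩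
    have : g =ᶠ[𝓝 x] f := Quotient.exact hg
    filter_upwards [this, hg'] with y h1 h2 hy
    rw [← h1, h2 hy]
  · exact fun h => ⟨f, rfl, h⟩

/-! ## The sheaves `𝓞_X / I ^ e` and `I / I ^ (e + 1)` on the submanifold

The submanifold is given by its inclusion `ι : T → X` into the ambient manifold, and `I` is the
ideal sheaf of `range ι`.  All the sheaves are sheaves on `T`, and they are described as étalé
spaces: by their stalks, together with the local sections, that is the families of elements of
the stalks which are locally the classes of one holomorphic function on the ambient manifold. A
morphism of sheaves is a family of homomorphisms of the stalks that maps local sections to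
local sections. -/

variable {T : Type*} (ι : T → X)

/-- The stalk at `p` of the ideal sheaf `I` of the submanifold. -/
abbrev IdealStalk (p : T) : Ideal (HolGerm E (ι p)) := vanIdeal E (range ι) (ι p)

/-- The stalk at `p` of `𝓞_X / I ^ e`. For `e = 1` this is the structure sheaf of the submanifold
and for `e = k + 1` that of its `k`-th infinitesimal neighbourhood. -/
def Quo (e : ℕ) (p : T) : Type _ := HolGerm E (ι p) ⧸ IdealStalk E ι p ^ e

instance Quo.commRing (e : ℕ) (p : T) : CommRing (Quo E ι e p) :=
  inferInstanceAs (CommRing (HolGerm E (ι p) ⧸ IdealStalk E ι p ^ e))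

/-- The class `[f]_e` in `𝓞_X / I ^ e`. -/
def Quo.mk (e : ℕ) (p : T) : HolGerm E (ι p) →+* Quo E ι e p :=
  Ideal.Quotient.mk (IdealStalk E ι p ^ e)

/-- The canonical projection `θ : 𝓞_X / I ^ e → 𝓞_X / I ^ e'` for `e' ≤ e`. -/
def Quo.proj {e e' : ℕ} (h : e' ≤ e) (p : T) : Quo E ι e p →+* Quo E ι e' p :=
  Ideal.Quotient.factor (Ideal.pow_le_pow_right h)

/-- The stalk at `p` of `I / I ^ (e + 1) = I / (I ^ e • I)`. -/
def Nil (e : ℕ) (p : T) : Type _ :=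
  IdealStalk E ι p ⧸ (IdealStalk E ι p ^ e • ⊤ : Submodule (HolGerm E (ι p)) (IdealStalk E ι p))

instance Nil.addCommGroup (e : ℕ) (p : T) : AddCommGroup (Nil E ι e p) :=
  inferInstanceAs (AddCommGroup (IdealStalk E ι p ⧸
    (IdealStalk E ι p ^ e • ⊤ : Submodule (HolGerm E (ι p)) (IdealStalk E ι p))))

instance Nil.holModule (e : ℕ) (p : T) : Module (HolGerm E (ι p)) (Nil E ι e p) :=
  inferInstanceAs (Module (HolGerm E (ι p)) (IdealStalk E ι p ⧸
    (IdealStalk E ι p ^ e • ⊤ : Submodule (HolGerm E (ι p)) (IdealStalk E ι p))))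

/-- The class `[f]_{e+1}` in `I / I ^ (e + 1)`. -/
def Nil.mk (e : ℕ) (p : T) : IdealStalk E ι p →ₗ[HolGerm E (ι p)] Nil E ι e p :=
  Submodule.mkQ (IdealStalk E ι p ^ e • ⊤ : Submodule (HolGerm E (ι p)) (IdealStalk E ι p))

/-- The canonical projection `I / I ^ (e + 2) → I / I ^ (e + 1)`. -/
def Nil.proj (e : ℕ) (p : T) : Nil E ι (e + 1) p →ₗ[HolGerm E (ι p)] Nil E ι e p :=
  Submodule.factor (Submodule.smul_mono_left (Ideal.pow_le_pow_right e.le_succ))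

/-- The canonical `𝓞_X / I ^ e`-module structure of `I / I ^ (e + 1)`. -/
instance Nil.quoModule (e : ℕ) (p : T) : Module (Quo E ι e p) (Nil E ι e p) :=
  Module.instQuotientIdealSubmoduleHSMulTop (IdealStalk E ι p) (IdealStalk E ι p ^ e)

variable {E ι}

theorem Quo.mk_surjective (e : ℕ) (p : T) : Function.Surjective (Quo.mk E ι e p) :=
  Ideal.Quotient.mk_surjective

theorem Quo.mk_eq_zero_iff {e : ℕ} {p : T} {f : HolGerm E (ι p)} :
    Quo.mk E ι e p f = 0 ↔ f ∈ IdealStalk E ι p ^ e :=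
  Ideal.Quotient.eq_zero_iff_mem

theorem Quo.proj_mk {e e' : ℕ} (h : e' ≤ e) (p : T) (f : HolGerm E (ι p)) :
    Quo.proj E ι h p (Quo.mk E ι e p f) = Quo.mk E ι e' p f :=
  rfl

theorem Nil.mk_surjective (e : ℕ) (p : T) : Function.Surjective (Nil.mk E ι e p) :=
  Submodule.mkQ_surjective _

theorem Nil.mk_eq_zero_iff {e : ℕ} {p : T} {f : IdealStalk E ι p} :
    Nil.mk E ι e p f = 0 ↔ (f : HolGerm E (ι p)) ∈ IdealStalk E ι p ^ (e + 1) := by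
  have h : Nil.mk E ι e p f = 0 ↔ f ∈ (IdealStalk E ι p ^ e • ⊤ :
      Submodule (HolGerm E (ι p)) (IdealStalk E ι p)) := Submodule.Quotient.mk_eq_zero _
  rw [h, Submodule.mem_smul_top_iff, smul_eq_mul, pow_succ]

theorem Nil.proj_mk (e : ℕ) (p : T) (f : IdealStalk E ι p) :
    Nil.proj E ι e p (Nil.mk E ι (e + 1) p f) = Nil.mk E ι e p f :=
  rfl

theorem Nil.mk_smul_mk {e : ℕ} {p : T} (f : HolGerm E (ι p)) (g : IdealStalk E ι p) :
    Quo.mk E ι e p f • Nil.mk E ι e p g = Nil.mk E ι e p (f • g) :=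
  rfl

/-- The function `f` is holomorphic near `ι p` and `a` is the class `[f]_e` of its germ. -/
def Quo.IsClass {e : ℕ} {p : T} (a : Quo E ι e p) (f : X → ℂ) : Prop :=
  ∃ hf : ContMDiffAt 𝓘(ℂ, E) 𝓘(ℂ) ω f (ι p),
    a = Quo.mk E ι e p (germAt f hf)

/-- The function `f` is holomorphic near `ι p`, it vanishes on the submanifold near `ι p`, and `a`
is the class `[f]_{e+1}` of its germ. -/
def Nil.IsClass {e : ℕ} {p : T} (a : Nil E ι e p) (f : X → ℂ) : Prop :=
  ∃ (hf : ContMDiffAt 𝓘(ℂ, E) 𝓘(ℂ) ω f (ι p)) (hI : germAt f hf ∈ IdealStalk E ι p),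
    a = Nil.mk E ι e p ⟨germAt f hf, hI⟩

theorem Quo.isClass_proj {e e' : ℕ} (h : e' ≤ e) {p : T} {a : Quo E ι e p} {f : X → ℂ}
    (ha : a.IsClass f) : (Quo.proj E ι h p a).IsClass f := by
  obtain ⟨hf, rfl⟩ := ha
  exact ⟨hf, rfl⟩

variable [TopologicalSpace T]

/-- The family `s` is a section of the sheaf `𝓞_X / I ^ e` on a neighbourhood of `p`. -/
def Quo.IsSectionNear {e : ℕ} (s : ∀ q : T, Quo E ι e q) (p : T) : Prop :=
  ∃ f : X → ℂ, ∀ᶠ q in 𝓝 p, (s q).IsClass f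

/-- The family `s` is a section of the sheaf `I / I ^ (e + 1)` on a neighbourhood of `p`. -/
def Nil.IsSectionNear {e : ℕ} (s : ∀ q : T, Nil E ι e q) (p : T) : Prop :=
  ∃ f : X → ℂ, ∀ᶠ q in 𝓝 p, Nil.IsClass (s q) f

/-! ## Liftings and comfortable splitting sequences -/

variable (E ι) in
/-- A `k`-th order lifting: a morphism `ρ : 𝓞_S → 𝓞_X / I ^ (k + 1)` of sheaves of rings with
`θ_k ∘ ρ = id`. -/
structure Lifting (k : ℕ) where
  /-- the ring homomorphisms of the stalks -/
  toHom : ∀ p : T, Quo E ι 1 p →+* Quo E ι (k + 1) p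
  map_section : ∀ (s : ∀ q : T, Quo E ι 1 q) (p : T), Quo.IsSectionNear s p →
    Quo.IsSectionNear (fun q => toHom q (s q)) p
  proj_toHom : ∀ (p : T) (v : Quo E ι 1 p), Quo.proj E ι (Nat.le_add_left 1 k) p (toHom p v) = v

/-- The lifting `θ_{k,h} ∘ ρ` of order `h ≤ k` induced by a lifting `ρ` of order `k`. -/
def Lifting.induced {k : ℕ} (ρ : Lifting E ι k) {h : ℕ} (hk : h ≤ k) : Lifting E ι h where
  toHom p := (Quo.proj E ι (Nat.succ_le_succ hk) p).comp (ρ.toHom p)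
  map_section s p hs := by
    obtain ⟨f, hf⟩ := ρ.map_section s p hs
    exact ⟨f, hf.mono fun q hq => Quo.isClass_proj (Nat.succ_le_succ hk) hq⟩
  proj_toHom p v := by
    refine Eq.trans ?_ (ρ.proj_toHom p v)
    exact Ideal.Quotient.factor_comp_apply (Ideal.pow_le_pow_right (Nat.succ_le_succ hk))
      (Ideal.pow_le_pow_right (Nat.le_add_left 1 h)) (ρ.toHom p v)

/-- The scalar multiplication of `𝓞_S` on `I / I ^ (e + 1)`, for `e ≤ k + 1`, that is induced by a
`k`-th order lifting `ρ`: the canonical one of `𝓞_X / I ^ e`, restricted along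
`θ ∘ ρ : 𝓞_S → 𝓞_X / I ^ (k + 1) → 𝓞_X / I ^ e`. -/
def Lifting.act {k : ℕ} (ρ : Lifting E ι k) {e : ℕ} (he : e ≤ k + 1) {p : T} (v : Quo E ι 1 p)
    (u : Nil E ι e p) : Nil E ι e p :=
  Quo.proj E ι he p (ρ.toHom p v) • u

/-- The submanifold is `k`-comfortably embedded with respect to the `k`-th order lifting `ρ`: there
are morphisms of sheaves `ν_j : I / I ^ (j + 1) → I / I ^ (j + 2)` for `0 ≤ j ≤ k`, linear for the
`𝓞_S`-module structures induced by `ρ`, that split the projections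
`I / I ^ (j + 2) → I / I ^ (j + 1)`. -/
def Lifting.IsComfortable {k : ℕ} (ρ : Lifting E ι k) : Prop :=
  ∃ ν : ∀ (j : ℕ) (p : T), Nil E ι j p →+ Nil E ι (j + 1) p, ∀ (j : ℕ) (hj : j ≤ k),
    (∀ (s : ∀ q : T, Nil E ι j q) (p : T), Nil.IsSectionNear s p →
      Nil.IsSectionNear (fun q => ν j q (s q)) p) ∧
    (∀ (p : T) (u : Nil E ι j p), Nil.proj E ι j p (ν j p u) = u) ∧
    (∀ (p : T) (v : Quo E ι 1 p) (u : Nil E ι j p),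
      ν j p (ρ.act (hj.trans k.le_succ) v u) = ρ.act (Nat.succ_le_succ hj) v (ν j p u))

end Stalks

/-- For two embeddings `ι : T → X` and `ι' : T → X'` of the same submanifold, an isomorphism
between the `k`-th infinitesimal neighbourhoods `(T, 𝓞_X / I ^ (k + 1))` and
`(T, 𝓞_X' / I' ^ (k + 1))` that induces the identity on `T`: an isomorphism `ψ` of sheaves of rings
which respects the restrictions to `T`. -/
def InfNbhdIso (E : Type*) [NormedAddCommGroup E] [NormedSpace ℂ E]
    {X : Type*} [TopologicalSpace X] [ChartedSpace E X]
    (E' : Type*) [NormedAddCommGroup E'] [NormedSpace ℂ E']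
    {X' : Type*} [TopologicalSpace X'] [ChartedSpace E' X']
    {T : Type*} [TopologicalSpace T] (ι : T → X) (ι' : T → X') (k : ℕ) : Prop :=
  ∃ ψ : ∀ p : T, Quo E' ι' (k + 1) p ≃+* Quo E ι (k + 1) p,
    (∀ (s : ∀ q : T, Quo E' ι' (k + 1) q) (p : T), Quo.IsSectionNear s p →
      Quo.IsSectionNear (fun q => ψ q (s q)) p) ∧
    (∀ (s : ∀ q : T, Quo E ι (k + 1) q) (p : T), Quo.IsSectionNear s p →
      Quo.IsSectionNear (fun q => (ψ q).symm (s q)) p) ∧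
    (∀ (p : T) (a : Quo E' ι' (k + 1) p) (f' : X' → ℂ) (f : X → ℂ),
      a.IsClass f' → (ψ p a).IsClass f → ∀ᶠ q in 𝓝 p, f' (ι' q) = f (ι q))

/-! ## Complex submanifolds and the normal bundle -/

/-- The space `ℂᵐ × ℂᵈ` of adapted coordinates `(z', z'')`. -/
abbrev Model (m d : ℕ) : Type := (Fin m → ℂ) × (Fin d → ℂ)

section Submanifold

variable (E : Type*) [NormedAddCommGroup E] [NormedSpace ℂ E]
  {M : Type*} [TopologicalSpace M] [ChartedSpace E M]

/-- A holomorphic chart `z = (z', z'')` of `M` adapted to `S`: a biholomorphic map of an open subset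
`U` of `M` onto an open subset of `ℂᵐ × ℂᵈ` such that `U ∩ S = {z' = 0}`. -/
structure AdaptedChart (S : Set M) (m d : ℕ) where
  /-- the chart -/
  toChart : OpenPartialHomeomorph M (Model m d)
  holo : ContMDiffOn 𝓘(ℂ, E) 𝓘(ℂ, Model m d) ω toChart toChart.source
  holo_symm : ContMDiffOn 𝓘(ℂ, Model m d) 𝓘(ℂ, E) ω toChart.symm toChart.target
  mem_iff : ∀ x ∈ toChart.source, x ∈ S ↔ (toChart x).1 = 0

/-- A (not necessarily closed) complex submanifold of codimension `m` and dimension `d`. -/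
structure Submfd (M : Type*) [TopologicalSpace M] [ChartedSpace E M] (m d : ℕ) where
  /-- the underlying set -/
  carrier : Set M
  exists_chart : ∀ x ∈ carrier, ∃ φ : AdaptedChart E carrier m d, x ∈ φ.toChart.source

/-- The tangent space `T_x S` as a subspace of `T_x M`: the tangent vectors that are annihilated by
the differentials of all the holomorphic germs vanishing on `S`. -/
def tangentTo (S : Set M) (x : M) : Submodule ℂ (TangentSpace 𝓘(ℂ, E) x) where
  carrier := {v | ∀ f : M → ℂ, ContMDiffAt 𝓘(ℂ, E) 𝓘(ℂ) ω f x →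
    (∀ᶠ y in 𝓝 x, y ∈ S → f y = 0) → mfderiv 𝓘(ℂ, E) 𝓘(ℂ) f x v = 0}
  add_mem' h1 h2 f hf hf' := by rw [map_add, h1 f hf hf', h2 f hf hf', add_zero]
  zero_mem' f _ _ := map_zero _
  smul_mem' c v h f hf hf' := by rw [map_smul, h f hf hf', smul_zero]

variable {E} {m d : ℕ}

/-- The (total space of the) normal bundle `TM|_S / TS`. -/
def NormalBundle (S : Submfd E M m d) : Type _ :=
  Σ p : S.carrier, TangentSpace 𝓘(ℂ, E) (p : M) ⧸ tangentTo E S.carrier (p : M)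

/-- The zero section of the normal bundle. -/
def zeroSection (S : Submfd E M m d) (p : S.carrier) : NormalBundle S := ⟨p, 0⟩

namespace AdaptedChart

variable {S : Set M} (φ : AdaptedChart E S m d)

/-- The differential of an adapted chart. -/
def diff (x : M) : TangentSpace 𝓘(ℂ, E) x →L[ℂ] Model m d :=
  mfderiv 𝓘(ℂ, E) 𝓘(ℂ, Model m d) φ.toChart x

/-- The differential of the inverse of an adapted chart. -/
def diffSymm (x : M) : Model m d →L[ℂ] TangentSpace 𝓘(ℂ, E) x :=
  mfderiv 𝓘(ℂ, Model m d) 𝓘(ℂ, E) φ.toChart.symm (φ.toChart x)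

theorem contMDiffAt {x : M} (hx : x ∈ φ.toChart.source) :
    ContMDiffAt 𝓘(ℂ, E) 𝓘(ℂ, Model m d) ω φ.toChart x :=
  φ.holo.contMDiffAt (φ.toChart.open_source.mem_nhds hx)

theorem contMDiffAt_symm {u : Model m d} (hu : u ∈ φ.toChart.target) :
    ContMDiffAt 𝓘(ℂ, Model m d) 𝓘(ℂ, E) ω φ.toChart.symm u :=
  φ.holo_symm.contMDiffAt (φ.toChart.open_target.mem_nhds hu)

theorem hasDiff {x : M} (hx : x ∈ φ.toChart.source) :
    HasMFDerivAt 𝓘(ℂ, E) 𝓘(ℂ, Model m d) φ.toChart x (φ.diff x) :=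
  ((φ.contMDiffAt hx).mdifferentiableAt (by simp)).hasMFDerivAt

theorem hasDiffSymm {x : M} (hx : x ∈ φ.toChart.source) :
    HasMFDerivAt 𝓘(ℂ, Model m d) 𝓘(ℂ, E) φ.toChart.symm (φ.toChart x) (φ.diffSymm x) :=
  ((φ.contMDiffAt_symm (φ.toChart.map_source hx)).mdifferentiableAt (by simp)).hasMFDerivAt

theorem diff_diffSymm {x : M} (hx : x ∈ φ.toChart.source) (u : Model m d) :
    φ.diff x (φ.diffSymm x u) = u := by
  have key : ∀ y, y = x → HasMFDerivAt 𝓘(ℂ, E) 𝓘(ℂ, Model m d) φ.toChart y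
      (show E →L[ℂ] Model m d from φ.diff x) := by
    rintro _ rfl
    exact φ.hasDiff hx
  have h1 := HasMFDerivAt.comp (φ.toChart x) (key _ (φ.toChart.left_inv hx)) (φ.hasDiffSymm hx)
  have h2 : HasMFDerivAt 𝓘(ℂ, Model m d) 𝓘(ℂ, Model m d) (φ.toChart ∘ φ.toChart.symm)
      (φ.toChart x) (ContinuousLinearMap.id ℂ (Model m d)) := by
    refine (hasMFDerivAt_id (I := 𝓘(ℂ, Model m d)) (φ.toChart x)).congr_of_eventuallyEq ?_
    filter_upwards [φ.toChart.open_target.mem_nhds (φ.toChart.map_source hx)] with y hy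
    exact φ.toChart.right_inv hy
  exact DFunLike.congr_fun (hasMFDerivAt_unique h1 h2) u

theorem diffSymm_diff {x : M} (hx : x ∈ φ.toChart.source) (v : TangentSpace 𝓘(ℂ, E) x) :
    φ.diffSymm x (φ.diff x v) = v := by
  have h1 := HasMFDerivAt.comp x (φ.hasDiffSymm hx) (φ.hasDiff hx)
  have h2 : HasMFDerivAt 𝓘(ℂ, E) 𝓘(ℂ, E) (φ.toChart.symm ∘ φ.toChart) x
      (ContinuousLinearMap.id ℂ E) := by
    refine (hasMFDerivAt_id (I := 𝓘(ℂ, E)) x).congr_of_eventuallyEq ?_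
    filter_upwards [φ.toChart.open_source.mem_nhds hx] with y hy
    exact φ.toChart.left_inv hy
  exact DFunLike.congr_fun (hasMFDerivAt_unique h1 h2) v

theorem symm_mem {u : Model m d} (hu : u ∈ φ.toChart.target) (h0 : u.1 = 0) :
    φ.toChart.symm u ∈ S := by
  rw [φ.mem_iff _ (φ.toChart.map_target hu), φ.toChart.right_inv hu, h0]

theorem mem_tangentTo_iff {x : M} (hx : x ∈ φ.toChart.source) (hS : x ∈ S)
    (v : TangentSpace 𝓘(ℂ, E) x) : v ∈ tangentTo E S x ↔ (φ.diff x v).1 = 0 := by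
  constructor
  · intro hv
    funext i
    let L : Model m d →L[ℂ] ℂ :=
      (ContinuousLinearMap.proj i).comp (ContinuousLinearMap.fst ℂ (Fin m → ℂ) (Fin d → ℂ))
    have h1 := HasMFDerivAt.comp x (L.hasMFDerivAt (x := φ.toChart x)) (φ.hasDiff hx)
    have h2 := hv (L ∘ φ.toChart)
      (L.contMDiff.contMDiffAt.comp x (φ.contMDiffAt hx)) (by
        filter_upwards [φ.toChart.open_source.mem_nhds hx] with y hy hyS
        have := (φ.mem_iff y hy).1 hyS
        simp [L, this])
    rw [h1.mfderiv] at h2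
    exact h2
  · intro hv f hf hf0
    have hfd := (hf.mdifferentiableAt (by simp)).hasMFDerivAt
    have key : ∀ y, y = x → HasMFDerivAt 𝓘(ℂ, E) 𝓘(ℂ) f y
        (show E →L[ℂ] ℂ from mfderiv 𝓘(ℂ, E) 𝓘(ℂ) f x) := by
      rintro _ rfl
      exact hfd
    have h1 := HasMFDerivAt.comp (φ.toChart x) (key _ (φ.toChart.left_inv hx)) (φ.hasDiffSymm hx)
    have h2 : HasFDerivAt (f ∘ φ.toChart.symm)
        ((show E →L[ℂ] ℂ from mfderiv 𝓘(ℂ, E) 𝓘(ℂ) f x).comp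
          (show Model m d →L[ℂ] E from φ.diffSymm x)) (φ.toChart x) := h1.hasFDerivAt
    have hx0 : φ.toChart x = (0, (φ.toChart x).2) := Prod.ext ((φ.mem_iff x hx).1 hS) rfl
    have hx1 := φ.toChart.map_source hx
    set y₀ := (φ.toChart x).2
    rw [hx0] at h2 hx1
    have h3 : HasFDerivAt (fun y : Fin d → ℂ => ((0, y) : Model m d))
        (ContinuousLinearMap.inr ℂ (Fin m → ℂ) (Fin d → ℂ)) y₀ := hasFDerivAt_prodMk_right 0 y₀
    have h4 := h2.comp y₀ h3
    have hc : ContinuousAt (fun y : Fin d → ℂ => φ.toChart.symm (0, y)) y₀ :=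
      ContinuousAt.comp (φ.toChart.symm.continuousAt hx1) h3.continuousAt
    have hz : (fun y : Fin d → ℂ => φ.toChart.symm (0, y)) y₀ = x := by
      change φ.toChart.symm (0, y₀) = x
      rw [← hx0, φ.toChart.left_inv hx]
    have h5 : (f ∘ φ.toChart.symm) ∘ (fun y : Fin d → ℂ => ((0, y) : Model m d))
        =ᶠ[𝓝 y₀] fun _ => 0 := by
      have e1 := hc.eventually (p := fun z => z ∈ S → f z = 0) (by rw [hz]; exact hf0)
      have e2 := h3.continuousAt.eventually (φ.toChart.open_target.mem_nhds hx1)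
      filter_upwards [e1, e2] with y hy1 hy2
      exact hy1 (φ.symm_mem hy2 rfl)
    have h6 := (h4.congr_of_eventuallyEq h5.symm).unique (hasFDerivAt_const (0 : ℂ) y₀)
    have h7 := DFunLike.congr_fun h6 (φ.diff x v).2
    have h8 : ((0, (φ.diff x v).2) : Model m d) = φ.diff x v := Prod.ext hv.symm rfl
    have h9 := φ.diffSymm_diff hx v
    rw [← h8] at h9
    rw [← h9]
    exact h7

end AdaptedChart

section BundleChart

variable {S : Submfd E M m d} (φ : AdaptedChart E S.carrier m d)

/-- The linear coordinates `N_p → ℂᵐ` on the fibre of the normal bundle at `p`, induced by the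
differential of `z'`. -/
def AdaptedChart.normalCoord (p : S.carrier) (hp : (p : M) ∈ φ.toChart.source) :
    (TangentSpace 𝓘(ℂ, E) (p : M) ⧸ tangentTo E S.carrier (p : M)) →ₗ[ℂ] (Fin m → ℂ) :=
  (tangentTo E S.carrier (p : M)).liftQ
    ((LinearMap.fst ℂ (Fin m → ℂ) (Fin d → ℂ)).comp (φ.diff (p : M)).toLinearMap)
    fun v hv => (φ.mem_tangentTo_iff hp p.2 v).1 hv

/-- The normal vector at `p` with given coordinates. -/
def AdaptedChart.normalVec (p : S.carrier) (w : Fin m → ℂ) : NormalBundle S :=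
  ⟨p, Submodule.Quotient.mk (φ.diffSymm (p : M) (w, 0))⟩

open scoped Classical in
/-- The map `(p, [v]) ↦ (dz'_p(v), z''(p))` on the normal bundle over the domain of an adapted chart
`z = (z', z'')` of `M`. -/
def AdaptedChart.bundleMap (n : NormalBundle S) : Model m d :=
  if h : (n.1 : M) ∈ φ.toChart.source then (φ.normalCoord n.1 h n.2, (φ.toChart n.1).2) else 0

theorem AdaptedChart.bundleMap_normalVec (p : S.carrier)
    (ψ : AdaptedChart E S.carrier m d) (hp' : (p : M) ∈ ψ.toChart.source) (w : Fin m → ℂ) :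
    ψ.bundleMap (φ.normalVec p w) =
      ((ψ.diff (p : M) (φ.diffSymm (p : M) (w, 0))).1, (ψ.toChart p).2) :=
  dif_pos (c := ((φ.normalVec p w).1 : M) ∈ ψ.toChart.source) hp'

theorem AdaptedChart.normalVec_normalCoord (p : S.carrier) (hp : (p : M) ∈ φ.toChart.source)
    (n : TangentSpace 𝓘(ℂ, E) (p : M) ⧸ tangentTo E S.carrier (p : M)) :
    φ.normalVec p (φ.normalCoord p hp n) = ⟨p, n⟩ := by
  obtain ⟨v, rfl⟩ := Submodule.Quotient.mk_surjective _ n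
  refine congrArg (Sigma.mk p) ?_
  rw [Submodule.Quotient.eq, φ.mem_tangentTo_iff hp p.2, map_sub, φ.diff_diffSymm hp]
  exact sub_self (φ.diff p v).1

theorem AdaptedChart.toChart_eq (p : S.carrier) (hp : (p : M) ∈ φ.toChart.source) :
    φ.toChart p = (0, (φ.toChart p).2) :=
  Prod.ext ((φ.mem_iff p hp).1 p.2) rfl

open scoped Classical in
/-- The chart of the normal bundle induced by an adapted chart `z = (z', z'')` of `M`: the class of
the tangent vector `v` at `p` is mapped to `(dz'_p(v), z''(p))`. (The point `p₀` only serves to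
give the inverse some value outside of the target.) -/
def AdaptedChart.bundleChart (p₀ : S.carrier) : PartialEquiv (NormalBundle S) (Model m d) where
  toFun := φ.bundleMap
  invFun u := if h : ((0, u.2) : Model m d) ∈ φ.toChart.target then
    φ.normalVec ⟨φ.toChart.symm (0, u.2), φ.symm_mem h rfl⟩ u.1 else zeroSection S p₀
  source := {n | (n.1 : M) ∈ φ.toChart.source}
  target := {u | ((0, u.2) : Model m d) ∈ φ.toChart.target}
  map_source' := by
    rintro ⟨p, n⟩ (hp : (p : M) ∈ φ.toChart.source)
    simp only [AdaptedChart.bundleMap, dif_pos hp, mem_ofPred_eq]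
    rw [← φ.toChart_eq p hp]
    exact φ.toChart.map_source hp
  map_target' := by
    rintro ⟨w, y⟩ (hu : ((0, y) : Model m d) ∈ φ.toChart.target)
    simp only [dif_pos hu, mem_ofPred_eq]
    exact φ.toChart.map_target hu
  left_inv' := by
    rintro ⟨p, n⟩ (hp : (p : M) ∈ φ.toChart.source)
    have h0 := φ.toChart_eq p hp
    have h1 : ((0, (φ.toChart p).2) : Model m d) ∈ φ.toChart.target := by
      rw [← h0]
      exact φ.toChart.map_source hp
    simp only [AdaptedChart.bundleMap, dif_pos hp, dif_pos h1]
    have h2 : (⟨φ.toChart.symm (0, (φ.toChart p).2), φ.symm_mem h1 rfl⟩ : S.carrier) = p := by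
      apply Subtype.ext
      change φ.toChart.symm (0, (φ.toChart p).2) = p
      rw [← h0, φ.toChart.left_inv hp]
    rw [h2, φ.normalVec_normalCoord]
  right_inv' := by
    rintro ⟨w, y⟩ (hu : ((0, y) : Model m d) ∈ φ.toChart.target)
    have hp := φ.toChart.map_target hu
    simp only [dif_pos hu]
    rw [φ.bundleMap_normalVec _ φ hp, φ.diff_diffSymm hp]
    refine Prod.ext rfl ?_
    change (φ.toChart (φ.toChart.symm (0, y))).2 = y
    rw [φ.toChart.right_inv hu]

/-- The change of coordinates between the two charts of the normal bundle that are induced by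
adapted charts `φ` and `ψ`. -/
def AdaptedChart.transition (ψ : AdaptedChart E S.carrier m d) (u : Model m d) : Model m d :=
  (fderiv ℂ (fun a => (ψ.toChart (φ.toChart.symm a)).1) (0, u.2) (u.1, 0),
    (ψ.toChart (φ.toChart.symm (0, u.2))).2)

theorem AdaptedChart.trans_source (ψ : AdaptedChart E S.carrier m d) (p₀ p₁ : S.carrier) :
    ((φ.bundleChart p₀).symm.trans (ψ.bundleChart p₁)).source =
      (fun u : Model m d => ((0, u.2) : Model m d)) ⁻¹'
        (φ.toChart.symm.trans ψ.toChart).source := by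
  ext ⟨w, y⟩
  have key : ∀ h : ((0, y) : Model m d) ∈ φ.toChart.target,
      (φ.bundleChart p₀).symm (w, y) =
        φ.normalVec ⟨φ.toChart.symm (0, y), φ.symm_mem h rfl⟩ w := fun h => dif_pos h
  constructor
  · rintro ⟨h1, h2⟩
    refine ⟨h1, ?_⟩
    have h3 : (((φ.bundleChart p₀).symm (w, y)).1 : M) ∈ ψ.toChart.source := h2
    rw [key h1] at h3
    exact h3
  · rintro ⟨h1, h2⟩
    refine ⟨h1, ?_⟩
    change (((φ.bundleChart p₀).symm (w, y)).1 : M) ∈ ψ.toChart.source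
    rw [key h1]
    exact h2

theorem AdaptedChart.isOpen_trans_source (ψ : AdaptedChart E S.carrier m d) (p₀ p₁ : S.carrier) :
    IsOpen ((φ.bundleChart p₀).symm.trans (ψ.bundleChart p₁)).source := by
  rw [φ.trans_source]
  exact (φ.toChart.symm.trans ψ.toChart).open_source.preimage (by fun_prop)

theorem AdaptedChart.contDiffOn_comp (ψ : AdaptedChart E S.carrier m d) :
    ContDiffOn ℂ ω (fun a => ψ.toChart (φ.toChart.symm a))
      (φ.toChart.symm.trans ψ.toChart).source := by
  rw [← contMDiffOn_iff_contDiffOn]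
  exact ψ.holo.comp (φ.holo_symm.mono fun a ha => ha.1) fun a ha => ha.2

theorem AdaptedChart.bundleChart_trans (ψ : AdaptedChart E S.carrier m d) (p₀ p₁ : S.carrier) :
    EqOn ((φ.bundleChart p₀).symm.trans (ψ.bundleChart p₁)) (φ.transition ψ)
      ((φ.bundleChart p₀).symm.trans (ψ.bundleChart p₁)).source := by
  rw [φ.trans_source]
  rintro ⟨w, y⟩ hu
  obtain ⟨h1, h2⟩ : ((0, y) : Model m d) ∈ φ.toChart.target ∧
    φ.toChart.symm (0, y) ∈ ψ.toChart.source := hu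
  have key : (φ.bundleChart p₀).symm (w, y) =
        φ.normalVec ⟨φ.toChart.symm (0, y), φ.symm_mem h1 rfl⟩ w := dif_pos h1
  change ψ.bundleMap ((φ.bundleChart p₀).symm (w, y)) = _
  have hs := φ.toChart.map_target h1
  rw [key, φ.bundleMap_normalVec _ ψ h2]
  refine Prod.ext ?_ rfl
  have e0 := φ.hasDiffSymm hs
  rw [φ.toChart.right_inv h1] at e0
  have e1 := (HasMFDerivAt.comp ((0, y) : Model m d) (ψ.hasDiff h2) e0).hasFDerivAt
  have e2 := ((ContinuousLinearMap.fst ℂ (Fin m → ℂ) (Fin d → ℂ)).hasFDerivAt).comp _ e1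
  have e3 := e2.fderiv
  exact (DFunLike.congr_fun e3 (w, 0)).symm

theorem AdaptedChart.contDiffOn_trans (ψ : AdaptedChart E S.carrier m d) (p₀ p₁ : S.carrier) :
    ContDiffOn ℂ ω ((φ.bundleChart p₀).symm.trans (ψ.bundleChart p₁))
      ((φ.bundleChart p₀).symm.trans (ψ.bundleChart p₁)).source := by
  refine ContDiffOn.congr ?_ (φ.bundleChart_trans ψ p₀ p₁)
  rw [φ.trans_source]
  have hc := φ.contDiffOn_comp ψ
  have ho := (φ.toChart.symm.trans ψ.toChart).open_source
  have hi : ContDiffOn ℂ ω (fun u : Model m d => ((0, u.2) : Model m d))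
      ((fun u : Model m d => ((0, u.2) : Model m d)) ⁻¹'
        (φ.toChart.symm.trans ψ.toChart).source) :=
    (contDiff_const.prodMk contDiff_snd).contDiffOn
  have hd := (hc.fst.fderiv_of_isOpen ho (m := ω) le_rfl).comp hi fun u hu => hu
  refine ContDiffOn.prodMk ?_ (hc.comp hi fun u hu => hu).snd
  exact hd.clm_apply (contDiff_fst.prodMk contDiff_const).contDiffOn

end BundleChart

variable (S : Submfd E M m d)

/-- The atlas of the normal bundle that consists of the charts induced by adapted charts. -/
def normalBundleCore : ChartedSpaceCore (Model m d) (NormalBundle S) where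
  atlas := {e | ∃ (φ : AdaptedChart E S.carrier m d) (p₀ : S.carrier), e = φ.bundleChart p₀}
  chartAt n := (S.exists_chart n.1 n.1.2).choose.bundleChart n.1
  mem_chart_source n := (S.exists_chart n.1 n.1.2).choose_spec
  chart_mem_atlas n := ⟨_, _, rfl⟩
  open_source := by
    rintro _ _ ⟨φ, p, rfl⟩ ⟨ψ, q, rfl⟩
    exact φ.isOpen_trans_source ψ p q
  continuousOn_toFun := by
    rintro _ _ ⟨φ, p, rfl⟩ ⟨ψ, q, rfl⟩
    exact (φ.contDiffOn_trans ψ p q).continuousOn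

instance NormalBundle.topologicalSpace : TopologicalSpace (NormalBundle S) :=
  (normalBundleCore S).toTopologicalSpace

instance NormalBundle.chartedSpace : ChartedSpace (Model m d) (NormalBundle S) :=
  (normalBundleCore S).toChartedSpace

/-- The normal bundle is a complex manifold. -/
instance NormalBundle.isManifold : IsManifold 𝓘(ℂ, Model m d) ω (NormalBundle S) := by
  apply isManifold_of_contDiffOn
  intro e e' he he'
  obtain ⟨_, ⟨φ, p, rfl⟩, rfl⟩ : ∃ c, ∃ hc : c ∈ (normalBundleCore S).atlas,
      e = (normalBundleCore S).openPartialHomeomorph c hc := by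
    simpa [atlas, ChartedSpace.atlas] using he
  obtain ⟨_, ⟨ψ, q, rfl⟩, rfl⟩ : ∃ c, ∃ hc : c ∈ (normalBundleCore S).atlas,
      e' = (normalBundleCore S).openPartialHomeomorph c hc := by
    simpa [atlas, ChartedSpace.atlas] using he'
  refine (φ.contDiffOn_trans ψ p q).mono ?_
  intro u hu
  exact hu.1

/-! ## The notions of the theorem -/

/-- A `k`-th order lifting of the submanifold `S` of `M`. -/
abbrev Submfd.Lifting (k : ℕ) : Type _ := CplxSub.Lifting E (Subtype.val : S.carrier → M) k

/-- `S` is `k`-linearizable: its `k`-th infinitesimal neighbourhoods in `M` and, as the zero section,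
in its normal bundle are isomorphic. -/
def Submfd.IsLinearizable (k : ℕ) : Prop :=
  InfNbhdIso E (Model m d) (Subtype.val : S.carrier → M) (zeroSection S) k

end Submanifold
end CplxSub

end

/-!
The proof presents both infinitesimal neighbourhoods as truncated polynomial rings over `𝓞_S`.

Let `I` be the ideal sheaf of a submanifold in adapted coordinates `z = (z', z'')`. By Hadamard's
lemma the `z'_i` generate `I` (`AdaptedChart.vanIdeal_eq_span`), and they are quasi-regular: a form of
degree `e` in the `z'_i` that lies in `I ^ (e + 1)` has its coefficients in `I`
(`AdaptedChart.coeff_mem_vanIdeal`). These two facts are all that is needed from analysis. They imply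
(`isFrame_eval₂Hom`) that a lifting of `𝓞_S` to `𝓞 / I ^ (k + 1)`, together with lifts of the classes of
the `z'_i` modulo `I ^ 2`, identifies the stalk of `𝓞 / I ^ (k + 1)` with the ring of polynomials over
`𝓞_S` modulo those without terms of degree at most `k`. For the normal bundle the lifting is the
pullback by the projection, and the lifts of the `z'_i` are the fibre coordinates `dz'_i`. Under a
change of adapted charts this presentation changes by the linear substitution whose matrix is that of
the conormal sheaf `I / I ^ 2` of `S` in `M` (`AdaptedChart.exists_normalFrame_eq`).

If `S` is linearizable, the isomorphism transports the pullback to a lifting `ρ` and the presentations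
of the normal bundle to presentations of `𝓞_M / I ^ (k + 1)`. Linear substitutions do not raise degrees,
so the polynomials of degree at most `j` form a subsheaf that does not depend on the chart. It is stable
under `ρ(𝓞_S)`, and it splits the projection `I / I ^ (j + 2) → I / I ^ (j + 1)`
(`FrameSystem.isComfortable`).

Conversely, composing the splittings of a comfortable embedding yields an `𝓞_S`-linear lifting of the
conormal sheaf to `I / I ^ (k + 1)` (`exists_conormal_lift`). Applied to the `z'_i` it gives presentations
of `𝓞_M / I ^ (k + 1)` which, by linearity, change with the chart by the same linear substitutions as
those of the normal bundle. Hence the isomorphisms obtained by matching the two presentations do not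
depend on the chart and form an isomorphism of sheaves (`isLinearizable_of_isComfortable`).

Sheaves being given by their stalks and local sections, the statements about sections rest on the fact
that two sections that agree at a point agree near it (`Quo.IsSectionNear.eventually_eq`). Only the
ring structure of the sheaves is used; in particular liftings need not be `ℂ`-linear.
-/

noncomputable section

namespace CplxSub

/-! ### Hadamard's lemma -/

section Hadamard

variable {𝕜 Z W : Type*} [NontriviallyNormedField 𝕜] [NormedAddCommGroup Z] [NormedSpace 𝕜 Z]
  [NormedAddCommGroup W] [NormedSpace 𝕜 W]

/-- The difference `f(b, …, b) - f(a, …, a)` as a telescoping sum, which replaces the entries `b` by `a`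
one at a time. -/
theorem sub_eq_sum_insertNth {n : ℕ} (f : ContinuousMultilinearMap 𝕜 (fun _ : Fin (n + 1) => Z) W)
    (a b : Z) :
    (f fun _ => b) - (f fun _ => a) =
      ∑ k : Fin (n + 1), f (k.insertNth (b - a) fun j : Fin n => if j.castSucc < k then a else b) := by
  let T : ℕ → W := fun k => f fun i => if (i : ℕ) < k then a else b
  have h0 : T 0 = f fun _ => b := by simp [T]
  have h1 : T (n + 1) = f fun _ => a := by
    simp only [T]
    congr 1
    funext i
    simp [i.2]
  rw [← h0, ← h1, ← Finset.sum_range_sub', Finset.sum_range]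
  refine Finset.sum_congr rfl fun k _ => ?_
  let m : Fin n → Z := fun j : Fin n => if j.castSucc < k then a else b
  have key : ∀ (c : Z) (l : ℕ), (∀ i : Fin (n + 1), (if (i : ℕ) < l then a else b) =
      if i = k then c else if i < k then a else b) → T l = f (k.insertNth c m) := by
    intro c l h
    simp only [T]
    congr 1
    funext i
    rw [h]
    refine Fin.succAboveCases k ?_ (fun j => ?_) i
    · simp
    · rw [if_neg (Fin.succAbove_ne k j), Fin.insertNth_apply_succAbove]
      simp only [m, Fin.succAbove_lt_iff_castSucc_lt]
  rw [key b k, key a (k + 1)]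
  · have := f.toMultilinearMap.map_update_sub (k.insertNth b m) k b a
    simp only [Fin.update_insertNth] at this
    exact this.symm
  · intro i
    rcases lt_trichotomy i k with h | h | h
    · have : (i : ℕ) < k + 1 := by omega
      simp [h, h.ne, this]
    · subst h; simp
    · have : ¬ (i : ℕ) < k + 1 := by have : (k : ℕ) < i := h; omega
      simp [h.ne', h.not_gt, this]
  · intro i
    by_cases h : i = k
    · subst h; simp
    · simp [h]

/-- The `k`-th term of the telescoping sum for `f(z, …, z) - f(π z, …, π z)`, as a multilinear map in
`z` whose value at `(z, …, z)` is the linear map `v ↦ f(π z, …, π z, v, z, …, z)`, with `v` in position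
`k`. -/
def hadamardTerm (π : Z →L[𝕜] Z) {n : ℕ}
    (f : ContinuousMultilinearMap 𝕜 (fun _ : Fin (n + 1) => Z) W) (k : Fin (n + 1)) :
    ContinuousMultilinearMap 𝕜 (fun _ : Fin n => Z) (Z →L[𝕜] W) :=
  (f.curryMid k).flipMultilinear.compContinuousLinearMap fun j : Fin n =>
    if j.castSucc < k then π else ContinuousLinearMap.id 𝕜 Z

theorem hadamardTerm_apply (π : Z →L[𝕜] Z) {n : ℕ}
    (f : ContinuousMultilinearMap 𝕜 (fun _ : Fin (n + 1) => Z) W) (k : Fin (n + 1)) (z v : Z) :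
    hadamardTerm π f k (fun _ => z) v =
      f (k.insertNth v fun j : Fin n => if j.castSucc < k then π z else z) := by
  simp only [hadamardTerm, ContinuousMultilinearMap.compContinuousLinearMap_apply,
    ContinuousLinearMap.flipMultilinear_apply_apply, ContinuousMultilinearMap.curryMid_apply]
  congr 2
  funext j
  split_ifs <;> rfl

theorem norm_hadamardTerm_le (π : Z →L[𝕜] Z) {n : ℕ}
    (f : ContinuousMultilinearMap 𝕜 (fun _ : Fin (n + 1) => Z) W) (k : Fin (n + 1)) :
    ‖hadamardTerm π f k‖ ≤ ‖f‖ * (max 1 ‖π‖) ^ n := by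
  refine (ContinuousMultilinearMap.norm_compContinuousLinearMap_le _ _).trans ?_
  have h1 : ‖(f.curryMid k).flipMultilinear‖ ≤ ‖f‖ := by
    rw [← ContinuousMultilinearMap.norm_curryMid k f]
    refine ContinuousMultilinearMap.opNorm_le_bound
      (norm_nonneg (ContinuousMultilinearMap.curryMid k f)) fun m => ?_
    refine ContinuousLinearMap.opNorm_le_bound _ (by positivity) fun v => ?_
    rw [ContinuousLinearMap.flipMultilinear_apply_apply, mul_right_comm]
    exact ((f.curryMid k v).le_opNorm m).trans
      (mul_le_mul_of_nonneg_right ((f.curryMid k).le_opNorm v) (by positivity))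
  refine mul_le_mul h1 ?_ (Finset.prod_nonneg fun _ _ => norm_nonneg _) (norm_nonneg f)
  refine (Finset.prod_le_prod (fun _ _ => norm_nonneg _) (g := fun _ => max 1 ‖π‖) ?_).trans ?_
  · intro j _
    split_ifs
    · exact le_max_right _ _
    · exact ContinuousLinearMap.norm_id_le.trans (le_max_left _ _)
  · simp

/-- Hadamard's lemma: the difference `F(z) - F(π z)` is linear in `z - π z`, with coefficients that
are analytic in `z`. It is proved by dividing each term of the power series of `F`, which needs no
integration and no finite-dimensionality. -/
theorem exists_hadamard [CompleteSpace W] {F : Z → W} {z₀ : Z} (hF : AnalyticAt 𝕜 F z₀)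
    (π : Z →L[𝕜] Z) (hπ : π z₀ = z₀) :
    ∃ G : Z → Z →L[𝕜] W, AnalyticAt 𝕜 G z₀ ∧ ∀ᶠ z in 𝓝 z₀, F z - F (π z) = G z (z - π z) := by
  obtain ⟨p, r, hp⟩ := hF
  let q : FormalMultilinearSeries 𝕜 Z (Z →L[𝕜] W) := fun n =>
    ∑ k : Fin (n + 1), hadamardTerm π (p (n + 1)) k
  set c : ℝ := max 1 ‖π‖ with hc
  have hc1 : 1 ≤ c := le_max_left _ _
  have hq : 0 < q.radius := by
    obtain ⟨s, hs0, hs⟩ := ENNReal.lt_iff_exists_nnreal_btwn.1 (hp.r_pos.trans_le hp.r_le)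
    have hs0' : 0 < (s : ℝ) := by exact_mod_cast hs0
    obtain ⟨C, hC0, hC⟩ := p.norm_mul_pow_le_of_lt_radius hs
    -- `q n` has `n + 1 ≤ 2 ^ n` summands, each of norm at most `‖p (n + 1)‖ * c ^ n`, so the radius of
    -- convergence shrinks at most by the factor `2 * c`
    let t : NNReal := ⟨s / (2 * c), by positivity⟩
    have ht : 0 < (t : ENNReal) := by
      have : 0 < (t : ℝ) := show 0 < (s : ℝ) / (2 * c) by positivity
      exact_mod_cast this
    refine ht.trans_le (q.le_radius_of_bound (C / s) fun n => ?_)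
    have hn : ‖q n‖ ≤ (n + 1) * (‖p (n + 1)‖ * c ^ n) := by
      refine (norm_sum_le Finset.univ fun k => hadamardTerm π (p (n + 1)) k).trans ?_
      refine (Finset.sum_le_sum fun k _ => norm_hadamardTerm_le π (p (n + 1)) k).trans ?_
      simp [hc]
    have h2 : ((n : ℝ) + 1) ≤ 2 ^ n := by exact_mod_cast n.lt_two_pow_self
    have h3 : (t : ℝ) ^ n = s ^ n / (2 ^ n * c ^ n) := by
      change ((s : ℝ) / (2 * c)) ^ n = _
      rw [div_pow, mul_pow]
    have h4 := hC (n + 1)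
    rw [h3, le_div_iff₀ hs0']
    calc ‖q n‖ * (s ^ n / (2 ^ n * c ^ n)) * s
        ≤ ((n + 1) * (‖p (n + 1)‖ * c ^ n)) * (s ^ n / (2 ^ n * c ^ n)) * s := by gcongr
      _ ≤ (2 ^ n * (‖p (n + 1)‖ * c ^ n)) * (s ^ n / (2 ^ n * c ^ n)) * s := by gcongr
      _ = ‖p (n + 1)‖ * s ^ (n + 1) := by
        have : c ≠ 0 := by positivity
        field_simp
        ring
      _ ≤ C := h4
  have hq' := q.hasFPowerSeriesOnBall hq
  refine ⟨fun z => q.sum (z - z₀), ?_, ?_⟩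
  · have h1 : AnalyticAt 𝕜 q.sum (z₀ - z₀) := by
      rw [sub_self]
      exact hq'.analyticAt
    exact AnalyticAt.comp (f := fun z => z - z₀) h1 (analyticAt_id.sub analyticAt_const)
  · have e1 : ∀ᶠ z in 𝓝 z₀, z - z₀ ∈ Metric.eball (0 : Z) r := by
      have : ContinuousAt (fun z => z - z₀) z₀ := by fun_prop
      refine this.eventually_mem ?_
      simp only [sub_self]
      exact Metric.eball_mem_nhds 0 hp.r_pos
    have e2 : ∀ᶠ z in 𝓝 z₀, π (z - z₀) ∈ Metric.eball (0 : Z) r := by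
      have : ContinuousAt (fun z => π (z - z₀)) z₀ := by fun_prop
      refine this.eventually_mem ?_
      simp only [sub_self, map_zero]
      exact Metric.eball_mem_nhds 0 hp.r_pos
    have e3 : ∀ᶠ z in 𝓝 z₀, z - z₀ ∈ Metric.eball (0 : Z) q.radius := by
      have : ContinuousAt (fun z => z - z₀) z₀ := by fun_prop
      refine this.eventually_mem ?_
      simp only [sub_self]
      exact Metric.eball_mem_nhds 0 hq
    filter_upwards [e1, e2, e3] with z h1 h2 h3
    set w := z - z₀ with hw
    have s1 := hp.hasSum h1
    have s2 := hp.hasSum h2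
    have z1 : z₀ + w = z := by simp [hw]
    have z2 : z₀ + π w = π z := by rw [hw, map_sub, hπ]; simp
    have z3 : z - π z = w - π w := by rw [hw, map_sub, hπ]; abel
    rw [z1] at s1
    rw [z2] at s2
    have s3 := s1.sub s2
    have s4 := (ContinuousLinearMap.apply 𝕜 W (w - π w)).hasSum (hq'.hasSum h3)
    rw [zero_add] at s4
    refine s3.unique ?_
    rw [z3]
    rw [← hasSum_nat_add_iff' 1]
    simp only [Finset.range_one, Finset.sum_singleton]
    have t0 : ((p 0) fun _ => w) - ((p 0) fun _ => π w) = 0 := by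
      rw [sub_eq_zero]; congr 1; funext i; exact i.elim0
    rw [t0, sub_zero]
    have s5 : HasSum (fun n => q n (fun _ => w) (w - π w)) (q.sum w (w - π w)) := s4
    convert s5 using 1
    funext n
    change (p (n + 1) fun _ => w) - (p (n + 1) fun _ => π w) = q n (fun _ => w) (w - π w)
    rw [sub_eq_sum_insertNth]
    simp only [q, _root_.sum_apply, hadamardTerm_apply]

end Hadamard

/-! ### Germs of holomorphic functions -/

section Germs

variable {E : Type*} [NormedAddCommGroup E] [NormedSpace ℂ E]
  {X : Type*} [TopologicalSpace X] [ChartedSpace E X]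

theorem germAt_eq_iff {x : X} {f g : X → ℂ} {hf : ContMDiffAt 𝓘(ℂ, E) 𝓘(ℂ) ω f x}
    {hg : ContMDiffAt 𝓘(ℂ, E) 𝓘(ℂ) ω g x} : germAt f hf = germAt g hg ↔ f =ᶠ[𝓝 x] g := by
  rw [← Germ.coe_eq, ← Subtype.coe_inj]
  rfl

theorem exists_germAt {x : X} (a : HolGerm E x) :
    ∃ (f : X → ℂ) (hf : ContMDiffAt 𝓘(ℂ, E) 𝓘(ℂ) ω f x), germAt f hf = a := by
  obtain ⟨_, f, hf, rfl⟩ := a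
  exact ⟨f, hf, rfl⟩

theorem germAt_add {x : X} {f g : X → ℂ} (hf : ContMDiffAt 𝓘(ℂ, E) 𝓘(ℂ) ω f x)
    (hg : ContMDiffAt 𝓘(ℂ, E) 𝓘(ℂ) ω g x) :
    germAt (f + g) (hf.add hg) = germAt f hf + germAt g hg := rfl

theorem germAt_sub {x : X} {f g : X → ℂ} (hf : ContMDiffAt 𝓘(ℂ, E) 𝓘(ℂ) ω f x)
    (hg : ContMDiffAt 𝓘(ℂ, E) 𝓘(ℂ) ω g x) :
    germAt (f - g) (hf.sub hg) = germAt f hf - germAt g hg := rfl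

theorem germAt_mul {x : X} {f g : X → ℂ} (hf : ContMDiffAt 𝓘(ℂ, E) 𝓘(ℂ) ω f x)
    (hg : ContMDiffAt 𝓘(ℂ, E) 𝓘(ℂ) ω g x) :
    germAt (f * g) (hf.mul hg) = germAt f hf * germAt g hg := rfl

theorem germAt_sum {x : X} {σ : Type*} (s : Finset σ) {f : σ → X → ℂ}
    (hf : ∀ i, ContMDiffAt 𝓘(ℂ, E) 𝓘(ℂ) ω (f i) x) :
    germAt (∑ i ∈ s, f i) (contMDiffAt_finsetSum' fun i _ => hf i) = ∑ i ∈ s, germAt (f i) (hf i) := by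
  classical
  induction s using Finset.induction_on with
  | empty => simp only [Finset.sum_empty]; rfl
  | insert a s ha ih =>
    rw [Finset.sum_insert (f := fun i => germAt (f i) (hf i)) ha, ← ih,
      ← germAt_add, germAt_eq_iff, Finset.sum_insert ha]

theorem germAt_prod {x : X} {σ : Type*} (s : Finset σ) {f : σ → X → ℂ}
    (hf : ∀ i, ContMDiffAt 𝓘(ℂ, E) 𝓘(ℂ) ω (f i) x) :
    germAt (∏ i ∈ s, f i) (contMDiffAt_finsetProd' fun i _ => hf i) = ∏ i ∈ s, germAt (f i) (hf i) := by
  classical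
  induction s using Finset.induction_on with
  | empty => simp only [Finset.prod_empty]; rfl
  | insert a s ha ih =>
    rw [Finset.prod_insert (f := fun i => germAt (f i) (hf i)) ha, ← ih,
      ← germAt_mul, germAt_eq_iff, Finset.prod_insert ha]

theorem eventually_contMDiffAt [IsManifold 𝓘(ℂ, E) ω X] {x : X} {f : X → ℂ}
    (hf : ContMDiffAt 𝓘(ℂ, E) 𝓘(ℂ) ω f x) :
    ∀ᶠ y in 𝓝 x, ContMDiffAt 𝓘(ℂ, E) 𝓘(ℂ) ω f y :=
  contMDiffAt_iff_contMDiffAt_nhds (by simp) |>.1 hf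

/-- Membership in a power of the ideal sheaf is an open condition. -/
theorem eventually_germAt_mem_pow [IsManifold 𝓘(ℂ, E) ω X] {Z : Set X} {x : X} {f : X → ℂ}
    {hf : ContMDiffAt 𝓘(ℂ, E) 𝓘(ℂ) ω f x} {e : ℕ} (h : germAt f hf ∈ vanIdeal E Z x ^ e) :
    ∀ᶠ y in 𝓝 x, ∀ hy : ContMDiffAt 𝓘(ℂ, E) 𝓘(ℂ) ω f y, germAt f hy ∈ vanIdeal E Z y ^ e := by
  induction e generalizing f with
  | zero => simp
  | succ e ih =>
    rw [pow_succ] at h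
    suffices H : ∀ a ∈ vanIdeal E Z x ^ e * vanIdeal E Z x, ∀ (f : X → ℂ)
        (hf : ContMDiffAt 𝓘(ℂ, E) 𝓘(ℂ) ω f x), a = germAt f hf → ∀ᶠ y in 𝓝 x,
        ∀ hy : ContMDiffAt 𝓘(ℂ, E) 𝓘(ℂ) ω f y, germAt f hy ∈ vanIdeal E Z y ^ (e + 1) from
      H _ h f hf rfl
    intro a ha
    refine Submodule.mul_induction_on ha ?_ ?_
    · intro b hb c hc f hf hfe
      obtain ⟨g, hg, rfl⟩ := exists_germAt b
      obtain ⟨k, hk, rfl⟩ := exists_germAt c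
      have h1 := (germAt_eq_iff.1 (hfe.symm.trans (germAt_mul hg hk).symm)).eventuallyEq_nhds
      have h2 := ((germAt_mem_vanIdeal E hk).1 hc).eventually_nhds
      filter_upwards [h1, h2, ih hb, eventually_contMDiffAt hg, eventually_contMDiffAt hk]
        with y y1 y2 y3 y4 y5 hy
      have : germAt f hy = germAt g y4 * germAt k y5 := by
        rw [← germAt_mul, germAt_eq_iff]
        exact y1
      rw [this, pow_succ]
      exact Ideal.mul_mem_mul (y3 y4) ((germAt_mem_vanIdeal E y5).2 y2)
    · intro b c ihb ihc f hf hfe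
      obtain ⟨g, hg, rfl⟩ := exists_germAt b
      obtain ⟨k, hk, rfl⟩ := exists_germAt c
      have h1 := (germAt_eq_iff.1 (hfe.symm.trans (germAt_add hg hk).symm)).eventuallyEq_nhds
      filter_upwards [h1, ihb g hg rfl, ihc k hk rfl, eventually_contMDiffAt hg,
        eventually_contMDiffAt hk] with y y1 y2 y3 y4 y5 hy
      have : germAt f hy = germAt g y4 + germAt k y5 := by
        rw [← germAt_add, germAt_eq_iff]
        exact y1
      rw [this]
      exact add_mem (y2 y4) (y3 y5)

end Germs

/-! ### The ideal of a submanifold in adapted coordinates -/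

namespace AdaptedChart

variable {E : Type*} [NormedAddCommGroup E] [NormedSpace ℂ E]
  {X : Type*} [TopologicalSpace X] [ChartedSpace E X] {Z : Set X} {m d : ℕ}
  (φ : AdaptedChart E Z m d)

/-- The coordinate function `z'_i` of an adapted chart `z = (z', z'')`. -/
def coord (i : Fin m) (y : X) : ℂ := (φ.toChart y).1 i

theorem contMDiffAt_coord {x : X} (hx : x ∈ φ.toChart.source) (i : Fin m) :
    ContMDiffAt 𝓘(ℂ, E) 𝓘(ℂ) ω (φ.coord i) x := by
  let L : Model m d →L[ℂ] ℂ :=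
    (ContinuousLinearMap.proj i).comp (ContinuousLinearMap.fst ℂ (Fin m → ℂ) (Fin d → ℂ))
  exact L.contMDiff.contMDiffAt.comp x (φ.contMDiffAt hx)

/-- The germ at `x` of the coordinate function `z'_i`. -/
def coordGerm {x : X} (hx : x ∈ φ.toChart.source) (i : Fin m) : HolGerm E x :=
  germAt (φ.coord i) (φ.contMDiffAt_coord hx i)

theorem analyticAt_comp_symm {x : X} (hx : x ∈ φ.toChart.source) {f : X → ℂ}
    (hf : ContMDiffAt 𝓘(ℂ, E) 𝓘(ℂ) ω f x) :
    AnalyticAt ℂ (fun u => f (φ.toChart.symm u)) (φ.toChart x) := by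
  have h1 : ContMDiffAt 𝓘(ℂ, E) 𝓘(ℂ) ω f (φ.toChart.symm (φ.toChart x)) := by
    rwa [φ.toChart.left_inv hx]
  have h2 := h1.comp (φ.toChart x) (φ.contMDiffAt_symm (φ.toChart.map_source hx))
  exact (contMDiffAt_iff_contDiffAt.1 h2).analyticAt

theorem contMDiffAt_comp {x : X} (hx : x ∈ φ.toChart.source) {F : Model m d → ℂ}
    (hF : AnalyticAt ℂ F (φ.toChart x)) :
    ContMDiffAt 𝓘(ℂ, E) 𝓘(ℂ) ω (fun y => F (φ.toChart y)) x :=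
  (contMDiffAt_iff_contDiffAt.2 (hF.contDiffAt)).comp x (φ.contMDiffAt hx)

theorem coordGerm_mem {x : X} (hx : x ∈ φ.toChart.source) (i : Fin m) :
    φ.coordGerm hx i ∈ vanIdeal E Z x := by
  rw [coordGerm, germAt_mem_vanIdeal]
  filter_upwards [φ.toChart.open_source.mem_nhds hx] with y hy hyZ
  rw [coord, (φ.mem_iff y hy).1 hyZ]
  rfl

/-- The germs of functions that vanish on the submanifold are generated by the coordinates `z'_i`.
-/
theorem vanIdeal_eq_span {x : X} (hx : x ∈ φ.toChart.source) (hZ : x ∈ Z) :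
    vanIdeal E Z x = Ideal.span (range (φ.coordGerm hx)) := by
  refine le_antisymm ?_ (Ideal.span_le.2 (range_subset_iff.2 (φ.coordGerm_mem hx)))
  intro a ha
  obtain ⟨f, hf, rfl⟩ := exists_germAt a
  rw [germAt_mem_vanIdeal] at ha
  set z₀ := φ.toChart x with hz₀
  have hz₁ : z₀.1 = 0 := (φ.mem_iff x hx).1 hZ
  -- Hadamard's lemma for the projection `(z', z'') ↦ (0, z'')` onto the submanifold
  let π : Model m d →L[ℂ] Model m d :=
    (ContinuousLinearMap.inr ℂ (Fin m → ℂ) (Fin d → ℂ)).comp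
      (ContinuousLinearMap.snd ℂ (Fin m → ℂ) (Fin d → ℂ))
  have hπ : π z₀ = z₀ := Prod.ext hz₁.symm rfl
  obtain ⟨G, hG, hG'⟩ := exists_hadamard (φ.analyticAt_comp_symm hx hf) π hπ
  have hc : ContinuousAt φ.toChart x := φ.toChart.continuousAt hx
  have hg : ∀ i, ContMDiffAt 𝓘(ℂ, E) 𝓘(ℂ) ω
      (fun y => G (φ.toChart y) ((Pi.single i 1, 0) : Model m d)) x := fun i =>
    φ.contMDiffAt_comp (F := fun u => G u (Pi.single i 1, 0)) hx
      (((ContinuousLinearMap.apply ℂ ℂ ((Pi.single i 1, 0) : Model m d)).analyticAt _).comp hG)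
  have key : germAt f hf = ∑ i, germAt _ (hg i) * φ.coordGerm hx i := by
    change _ = ∑ i, germAt _ (hg i) * germAt _ (φ.contMDiffAt_coord hx i)
    simp only [← germAt_mul]
    rw [← germAt_sum _ fun i => (hg i).mul (φ.contMDiffAt_coord hx i), germAt_eq_iff]
    have hπc : ContinuousAt (fun y => φ.toChart.symm (π (φ.toChart y))) x := by
      refine ContinuousAt.comp (f := fun y => π (φ.toChart y)) ?_ (π.continuous.continuousAt.comp hc)
      rw [← hz₀, hπ]
      exact φ.toChart.symm.continuousAt (φ.toChart.map_source hx)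
    have hπx : φ.toChart.symm (π (φ.toChart x)) = x := by
      rw [← hz₀, hπ, hz₀, φ.toChart.left_inv hx]
    have e1 := hπc.eventually (p := fun z => z ∈ Z → f z = 0) (by simpa only [hπx] using ha)
    have e2 : ∀ᶠ y in 𝓝 x, π (φ.toChart y) ∈ φ.toChart.target := by
      refine (π.continuous.continuousAt.comp hc).eventually_mem ?_
      change φ.toChart.target ∈ 𝓝 (π z₀)
      rw [hπ]
      exact φ.toChart.open_target.mem_nhds (φ.toChart.map_source hx)
    filter_upwards [hc.eventually hG', e1, e2, φ.toChart.open_source.mem_nhds hx] with y y1 y2 y3 y4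
    rw [y2 (φ.symm_mem y3 rfl), φ.toChart.left_inv y4, sub_zero] at y1
    rw [y1]
    have : φ.toChart y - π (φ.toChart y) =
        ∑ i, φ.coord i y • ((Pi.single i 1, 0) : Model m d) := by
      refine Prod.ext ?_ ?_
      · funext j
        simp [π, Prod.fst_sum, coord, Pi.single_apply]
      · simp [π, Prod.snd_sum]
    rw [this, map_sum, Finset.sum_apply]
    refine Finset.sum_congr rfl fun i _ => ?_
    rw [map_smul, smul_eq_mul, mul_comm]
    rfl
  rw [key]
  exact Ideal.sum_mem _ fun i _ => Ideal.mul_mem_left _ _ (Ideal.subset_span (mem_range_self i))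

/-- The point with coordinates `z' = t w` over the point `x` of the submanifold. -/
def curve (x : X) (w : Fin m → ℂ) (t : ℂ) : X := φ.toChart.symm (t • w, (φ.toChart x).2)

theorem curve_zero {x : X} (hx : x ∈ φ.toChart.source) (hZ : x ∈ Z) (w : Fin m → ℂ) :
    φ.curve x w 0 = x := by
  have : (((0 : ℂ) • w, (φ.toChart x).2) : Model m d) = φ.toChart x :=
    Prod.ext (by rw [zero_smul, (φ.mem_iff x hx).1 hZ]) rfl
  rw [curve, this, φ.toChart.left_inv hx]

theorem differentiableAt_comp_curve {x : X} (hx : x ∈ φ.toChart.source) (hZ : x ∈ Z)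
    (w : Fin m → ℂ) {f : X → ℂ} (hf : ContMDiffAt 𝓘(ℂ, E) 𝓘(ℂ) ω f x) :
    DifferentiableAt ℂ (fun t => f (φ.curve x w t)) 0 := by
  have h0 : (((0 : ℂ) • w, (φ.toChart x).2) : Model m d) = φ.toChart x :=
    Prod.ext (by rw [zero_smul, (φ.mem_iff x hx).1 hZ]) rfl
  have h1 := (φ.analyticAt_comp_symm hx hf).differentiableAt
  rw [← h0] at h1
  exact DifferentiableAt.comp (f := fun t : ℂ => ((t • w, (φ.toChart x).2) : Model m d)) (0 : ℂ) h1
    (by fun_prop)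

/-- A germ in the `e`-th power of the ideal vanishes to order `e` along the curves transverse to the
submanifold. -/
theorem isBigO_comp_curve {x : X} (hx : x ∈ φ.toChart.source) (hZ : x ∈ Z)
    (w : Fin m → ℂ) {f : X → ℂ} {hf : ContMDiffAt 𝓘(ℂ, E) 𝓘(ℂ) ω f x} {e : ℕ}
    (h : germAt f hf ∈ vanIdeal E Z x ^ e) :
    (fun t => f (φ.curve x w t)) =O[𝓝 0] fun t : ℂ => t ^ e := by
  have hcont : Tendsto (φ.curve x w) (𝓝 0) (𝓝 x) := by
    have h0 : (((0 : ℂ) • w, (φ.toChart x).2) : Model m d) = φ.toChart x :=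
      Prod.ext (by rw [zero_smul, (φ.mem_iff x hx).1 hZ]) rfl
    have h1 : ContinuousAt (fun t : ℂ => ((t • w, (φ.toChart x).2) : Model m d)) 0 := by fun_prop
    have h2 : ContinuousAt φ.toChart.symm ((fun t : ℂ => ((t • w, (φ.toChart x).2) : Model m d)) 0) := by
      simp only [h0]
      exact φ.toChart.symm.continuousAt (φ.toChart.map_source hx)
    have h3 : ContinuousAt (φ.curve x w) 0 := ContinuousAt.comp h2 h1
    have h4 := h3.tendsto
    rwa [φ.curve_zero hx hZ] at h4
  induction e generalizing f with
  | zero =>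
    simp only [pow_zero]
    exact (φ.differentiableAt_comp_curve hx hZ w hf).continuousAt.isBigO_one ℂ
  | succ e ih =>
    rw [pow_succ] at h
    suffices H : ∀ a ∈ vanIdeal E Z x ^ e * vanIdeal E Z x, ∀ (f : X → ℂ)
        (hf : ContMDiffAt 𝓘(ℂ, E) 𝓘(ℂ) ω f x), a = germAt f hf →
        (fun t => f (φ.curve x w t)) =O[𝓝 0] fun t : ℂ => t ^ (e + 1) from H _ h f hf rfl
    intro a ha
    refine Submodule.mul_induction_on ha ?_ ?_
    · intro b hb c hc f hf hfe
      obtain ⟨g, hg, rfl⟩ := exists_germAt b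
      obtain ⟨k, hk, rfl⟩ := exists_germAt c
      have h1 := hcont.eventually (germAt_eq_iff.1 (hfe.symm.trans (germAt_mul hg hk).symm))
      refine Asymptotics.IsBigO.congr' ((ih hb).mul ?_) (EventuallyEq.symm h1)
        (Eventually.of_forall fun t => (pow_succ t e).symm)
      have h2 := (φ.differentiableAt_comp_curve hx hZ w hk).isBigO_sub
      have h3 : k x = 0 := ((germAt_mem_vanIdeal E hk).1 hc).self_of_nhds hZ
      simpa [φ.curve_zero hx hZ, h3] using h2
    · intro b c ihb ihc f hf hfe
      obtain ⟨g, hg, rfl⟩ := exists_germAt b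
      obtain ⟨k, hk, rfl⟩ := exists_germAt c
      have h1 := hcont.eventually (germAt_eq_iff.1 (hfe.symm.trans (germAt_add hg hk).symm))
      exact Asymptotics.IsBigO.congr' ((ihb g hg rfl).add (ihc k hk rfl)) (EventuallyEq.symm h1)
        (Eventually.of_forall fun t => rfl)

theorem coord_curve {x : X} (hx : x ∈ φ.toChart.source) (hZ : x ∈ Z) (w : Fin m → ℂ) :
    ∀ᶠ t in 𝓝 (0 : ℂ), ∀ i, φ.coord i (φ.curve x w t) = t * w i := by
  have h0 : (((0 : ℂ) • w, (φ.toChart x).2) : Model m d) = φ.toChart x :=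
    Prod.ext (by rw [zero_smul, (φ.mem_iff x hx).1 hZ]) rfl
  have h1 : ContinuousAt (fun t : ℂ => ((t • w, (φ.toChart x).2) : Model m d)) 0 := by fun_prop
  have h2 := h1.eventually_mem (s := φ.toChart.target) (by
    simp only [h0]
    exact φ.toChart.open_target.mem_nhds (φ.toChart.map_source hx))
  filter_upwards [h2] with t ht i
  rw [coord, curve, φ.toChart.right_inv ht]
  rfl

/-- The coordinates `z'_i` form a quasi-regular sequence: if a form of degree `e` in the `z'_i` lies in
the `(e + 1)`-st power of the ideal, then its coefficients lie in the ideal. At each point `y` of the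
submanifold near `x`, restricting the form to the curves `z' = t w` shows that the form in `w` whose
coefficients are the values at `y` vanishes identically. -/
theorem coeff_mem_vanIdeal [IsManifold 𝓘(ℂ, E) ω X] {x : X} (hx : x ∈ φ.toChart.source) {e : ℕ}
    {P : MvPolynomial (Fin m) (HolGerm E x)} (hP : P.IsHomogeneous e)
    (h : MvPolynomial.eval (φ.coordGerm hx) P ∈ vanIdeal E Z x ^ (e + 1)) (α : Fin m →₀ ℕ) :
    P.coeff α ∈ vanIdeal E Z x := by
  choose F hF hFP using fun β => exists_germAt (P.coeff β)
  let g : X → ℂ := ∑ β ∈ P.support, F β * ∏ i, φ.coord i ^ β i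
  have hg : ∀ {y : X}, (∀ β, β ∈ P.support → ContMDiffAt 𝓘(ℂ, E) 𝓘(ℂ) ω (F β) y) →
      y ∈ φ.toChart.source → ContMDiffAt 𝓘(ℂ, E) 𝓘(ℂ) ω g y := fun h1 h2 =>
    contMDiffAt_finsetSum' fun β hβ => (h1 β hβ).mul
      (contMDiffAt_finsetProd' fun i _ => (φ.contMDiffAt_coord h2 i).pow _)
  have hgP : germAt g (hg (fun β _ => hF β) hx) = MvPolynomial.eval (φ.coordGerm hx) P := by
    rw [MvPolynomial.eval_eq']
    have hmon : ∀ β, P.coeff β * ∏ i, φ.coordGerm hx i ^ β i =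
        germAt (F β * ∏ i, φ.coord i ^ β i) ((hF β).mul
          (contMDiffAt_finsetProd' fun i _ => (φ.contMDiffAt_coord hx i).pow _)) := fun β => by
      rw [← hFP]
      exact congrArg (germAt (F β) (hF β) * ·) (germAt_prod Finset.univ (f := fun i => φ.coord i ^ β i)
        fun i => (φ.contMDiffAt_coord hx i).pow (β i)).symm
    simp only [hmon]
    exact germAt_sum _ _
  rw [← hgP] at h
  have hspread := eventually_germAt_mem_pow h
  have hFs : ∀ᶠ y in 𝓝 x, ∀ β ∈ P.support, ContMDiffAt 𝓘(ℂ, E) 𝓘(ℂ) ω (F β) y :=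
    (eventually_all_finset _).2 fun β _ => eventually_contMDiffAt (hF β)
  by_cases hα : α ∈ P.support
  swap
  · rw [MvPolynomial.notMem_support_iff.1 hα]
    exact zero_mem _
  rw [← hFP α, germAt_mem_vanIdeal]
  filter_upwards [hspread, hFs, φ.toChart.open_source.mem_nhds hx] with y y1 y2 y3 hyZ
  let p : MvPolynomial (Fin m) ℂ := ∑ β ∈ P.support, MvPolynomial.monomial β (F β y)
  have hp : p = 0 := by
    refine MvPolynomial.funext fun w => ?_
    let H : ℂ → ℂ := fun t => ∑ β ∈ P.support, F β (φ.curve y w t) * ∏ i, w i ^ β i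
    have hH0 : H 0 = MvPolynomial.eval w p := by
      simp [H, p, φ.curve_zero y3 hyZ, MvPolynomial.eval_monomial, Finsupp.prod_fintype]
    have hHc : ContinuousAt H 0 := by
      refine tendsto_finsetSum _ fun β hβ => Tendsto.mul_const _ ?_
      exact (φ.differentiableAt_comp_curve y3 hyZ w (y2 β hβ)).continuousAt
    have hgH : ∀ᶠ t in 𝓝 (0 : ℂ), g (φ.curve y w t) = t ^ e * H t := by
      filter_upwards [φ.coord_curve y3 hyZ w] with t ht
      simp only [g, H, Finset.sum_apply, Pi.mul_apply, Finset.prod_apply, Pi.pow_apply, ht,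
        Finset.mul_sum]
      refine Finset.sum_congr rfl fun β hβ => ?_
      have hdeg : ∑ i, β i = e := by
        rw [← hP (MvPolynomial.mem_support_iff.1 hβ), Finsupp.weight_apply,
          Finsupp.sum_fintype _ _ (by simp)]
        simp
      simp only [mul_pow, Finset.prod_mul_distrib, Finset.prod_pow_eq_pow_sum, hdeg]
      ring
    have hO := (φ.isBigO_comp_curve y3 hyZ w (y1 (hg y2 y3))).congr' hgH EventuallyEq.rfl
    have hO' : H =O[𝓝[≠] 0] fun t : ℂ => t := by
      obtain ⟨c, hc⟩ := (hO.mono (nhdsWithin_le_nhds (s := {0}ᶜ))).bound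
      refine Asymptotics.IsBigO.of_bound c ?_
      filter_upwards [hc, self_mem_nhdsWithin] with t ht ht0
      have ht0' : 0 < ‖t‖ ^ e := pow_pos (norm_pos_iff.2 ht0) e
      rw [norm_mul, norm_pow, norm_pow, pow_succ, mul_left_comm] at ht
      exact le_of_mul_le_mul_left ht ht0'
    have hT : Tendsto H (𝓝[≠] 0) (𝓝 0) :=
      hO'.trans_tendsto (tendsto_id.mono_left nhdsWithin_le_nhds)
    rw [map_zero, ← hH0]
    exact tendsto_nhds_unique (hHc.tendsto.mono_left nhdsWithin_le_nhds) hT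
  have := congrArg (MvPolynomial.coeff α) hp
  simpa [p, MvPolynomial.coeff_sum, MvPolynomial.coeff_monomial, hα] using this

end AdaptedChart

/-! ### Filtered rings with polynomial associated graded ring -/

section Frames

open MvPolynomial

variable {A Q R σ : Type*} [CommRing A] [CommRing Q] [CommRing R]

/-- A presentation of the ring `Q` with ideal `K`, where `K ^ n = 0`, as a truncated polynomial ring
over `R`: a surjective ring homomorphism `Φ : R[X_i] → Q` such that `Φ⁻¹(K ^ e)` consists, for
`e ≤ n`, of the polynomials without terms of degree less than `e`. -/
structure IsFrame (K : Ideal Q) (n : ℕ) (Φ : MvPolynomial σ R →+* Q) : Prop where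
  surjective : Function.Surjective Φ
  mem_pow_iff : ∀ e ≤ n, ∀ P, Φ P ∈ K ^ e ↔ ∀ α : σ →₀ ℕ, α.degree < e → P.coeff α = 0
  pow_eq_bot : K ^ n = ⊥

theorem IsFrame.map_eq_zero_iff {K : Ideal Q} {n : ℕ} {Φ : MvPolynomial σ R →+* Q}
    (h : IsFrame K n Φ) {P : MvPolynomial σ R} :
    Φ P = 0 ↔ ∀ α : σ →₀ ℕ, α.degree < n → P.coeff α = 0 := by
  rw [← h.mem_pow_iff n le_rfl, h.pow_eq_bot]
  exact Iff.rfl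

theorem IsFrame.comp_ringEquiv {Q' : Type*} [CommRing Q'] {K : Ideal Q} {n : ℕ}
    {Φ : MvPolynomial σ R →+* Q} (h : IsFrame K n Φ) (ψ : Q ≃+* Q') {K' : Ideal Q'}
    (hK : ∀ q, ψ q ∈ K' ↔ q ∈ K) : IsFrame K' n ((ψ : Q →+* Q').comp Φ) := by
  have hmap : K' = K.map ψ := by
    ext q
    obtain ⟨q, rfl⟩ := ψ.surjective q
    rw [hK, Ideal.mem_map_of_equiv]
    simp
  have hpow : ∀ e q, ψ q ∈ K' ^ e ↔ q ∈ K ^ e := fun e q => by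
    rw [hmap, ← Ideal.map_pow, Ideal.mem_map_of_equiv]
    simp
  refine ⟨ψ.surjective.comp h.surjective, fun e he P => ?_, ?_⟩
  · rw [← h.mem_pow_iff e he P]
    exact hpow e _
  · rw [hmap, ← Ideal.map_pow, h.pow_eq_bot, Ideal.map_bot]

theorem evalMonomial_mem_pow {K : Ideal Q} {ξ : σ → Q} (hξ : ∀ i, ξ i ∈ K) (α : σ →₀ ℕ) :
    (α.prod fun i j => ξ i ^ j) ∈ K ^ α.degree := by
  induction α using Finsupp.induction_linear with
  | zero => simp
  | add α β hα hβ =>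
    rw [Finsupp.prod_add_index' (by simp) (by simp [pow_add]), map_add, pow_add]
    exact Ideal.mul_mem_mul hα hβ
  | single i j =>
    simpa using Ideal.pow_mem_pow (hξ i) j

theorem evalMonomial_sub_mem_pow {K : Ideal Q} {ξ y : σ → Q} (hy : ∀ i, y i ∈ K)
    (hξy : ∀ i, ξ i - y i ∈ K ^ 2) (α : σ →₀ ℕ) :
    (α.prod fun i j => ξ i ^ j) - (α.prod fun i j => y i ^ j) ∈ K ^ (α.degree + 1) := by
  have hξ : ∀ i, ξ i ∈ K := fun i => by
    have := add_mem (Ideal.pow_le_self two_ne_zero (hξy i)) (hy i)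
    rwa [sub_add_cancel] at this
  have hadd : ∀ α β : σ →₀ ℕ,
      ((α.prod fun i j => ξ i ^ j) - (α.prod fun i j => y i ^ j) ∈ K ^ (α.degree + 1)) →
      ((β.prod fun i j => ξ i ^ j) - (β.prod fun i j => y i ^ j) ∈ K ^ (β.degree + 1)) →
      (((α + β).prod fun i j => ξ i ^ j) - ((α + β).prod fun i j => y i ^ j) ∈
        K ^ ((α + β).degree + 1)) := by
    intro α β hα hβ
    rw [Finsupp.prod_add_index' (by simp) (by simp [pow_add]),
      Finsupp.prod_add_index' (by simp) (by simp [pow_add]), map_add]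
    have h1 := Ideal.mul_mem_mul (evalMonomial_mem_pow hξ α) hβ
    have h2 := Ideal.mul_mem_mul hα (evalMonomial_mem_pow hy β)
    rw [← pow_add] at h1 h2
    rw [← add_assoc] at h1
    rw [add_right_comm] at h2
    convert add_mem h1 h2 using 1
    ring
  induction α using Finsupp.induction_linear with
  | zero => simp
  | add α β hα hβ => exact hadd α β hα hβ
  | single i j =>
    induction j with
    | zero => simp
    | succ j ih =>
      rw [Finsupp.single_add]
      refine hadd _ _ ih ?_
      simpa using hξy i

theorem eval₂_eq_sum_prod (ρ : R →+* Q) (ξ : σ → Q) (P : MvPolynomial σ R) {s : Finset (σ →₀ ℕ)}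
    (hs : P.support ⊆ s) :
    eval₂Hom ρ ξ P = ∑ α ∈ s, ρ (P.coeff α) * α.prod fun i j => ξ i ^ j := by
  change P.eval₂ ρ ξ = _
  rw [MvPolynomial.eval₂_eq]
  simp only [Finsupp.prod]
  refine Finset.sum_subset hs fun α _ hα => ?_
  rw [notMem_support_iff.1 hα, map_zero, zero_mul]

/-- Let `I` be generated by a quasi-regular family `x`. Every lifting `ρ` of `R ≃ A / I` to
`Q = A / I ^ n`, together with lifts `ξ` to `Q` of the classes of the `x_i` modulo `I ^ 2`, presents
`Q` as a truncated polynomial ring. -/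
theorem isFrame_eval₂Hom {I : Ideal A} {x : σ → A} (hI : I = Ideal.span (range x))
    (hx : ∀ (e : ℕ) (P : MvPolynomial σ A), P.IsHomogeneous e → eval x P ∈ I ^ (e + 1) →
      ∀ α, P.coeff α ∈ I)
    {π : A →+* Q} (hπ : Function.Surjective π) {n : ℕ} (hker : ∀ a, π a = 0 ↔ a ∈ I ^ n)
    {ρ : R →+* Q} (hinj : ∀ r, ρ r ∈ I.map π → r = 0)
    (hsurj : ∀ a, ∃ r, ρ r - π a ∈ I.map π)
    {ξ : σ → Q} (hξ : ∀ i, ξ i - π (x i) ∈ (I.map π) ^ 2) :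
    IsFrame (I.map π) n (eval₂Hom ρ ξ) := by
  classical
  set K := I.map π with hK
  have hxI : ∀ i, x i ∈ I := fun i => hI ▸ Ideal.subset_span (mem_range_self i)
  have hxK : ∀ i, π (x i) ∈ K := fun i => Ideal.mem_map_of_mem π (hxI i)
  have hξK : ∀ i, ξ i ∈ K := fun i => by
    have := add_mem (Ideal.pow_le_self two_ne_zero (hξ i)) (hxK i)
    rwa [sub_add_cancel] at this
  have hmem : ∀ e ≤ n, ∀ a, π a ∈ K ^ e ↔ a ∈ I ^ e := by
    intro e he a
    rw [hK, ← Ideal.map_pow, Ideal.mem_map_iff_of_surjective π hπ]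
    constructor
    · rintro ⟨b, hb, hab⟩
      have h1 : a - b ∈ I ^ n := by rw [← hker, map_sub, hab, sub_self]
      have := add_mem (Ideal.pow_le_pow_right he h1) hb
      rwa [sub_add_cancel] at this
    · exact fun ha => ⟨a, ha, rfl⟩
  have hbot : K ^ n = ⊥ := by
    rw [eq_bot_iff]
    intro q hq
    obtain ⟨a, rfl⟩ := hπ q
    exact (hker a).2 ((hmem n le_rfl a).1 hq)
  -- a form over `R` and a form over `A` with the same coefficients modulo `K`
  have hform : ∀ (e : ℕ) (P : MvPolynomial σ R) (P' : MvPolynomial σ A), P.IsHomogeneous e →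
      P'.IsHomogeneous e → (∀ α, ρ (P.coeff α) - π (P'.coeff α) ∈ K) →
      eval₂Hom ρ ξ P - π (eval x P') ∈ K ^ (e + 1) := by
    intro e P P' hP hP' hc
    have h1 : π (eval x P') = eval₂Hom π (fun i => π (x i)) P' := by
      change _ = P'.eval₂ π (fun i => π (x i))
      rw [MvPolynomial.eval, coe_eval₂Hom, MvPolynomial.hom_eval₂]
      rfl
    rw [h1, eval₂_eq_sum_prod ρ ξ P (Finset.subset_union_left (s₂ := P'.support)),
      eval₂_eq_sum_prod π _ P' (Finset.subset_union_right (s₁ := P.support)),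
      ← Finset.sum_sub_distrib]
    refine Ideal.sum_mem _ fun α hα => ?_
    have hdeg : α.degree = e := by
      by_contra hne
      rw [Finset.mem_union, mem_support_iff, mem_support_iff, hP.coeff_eq_zero hne,
        hP'.coeff_eq_zero hne] at hα
      simp at hα
    have h2 := Ideal.mul_mem_left (K ^ (e + 1)) (ρ (P.coeff α))
      (hdeg ▸ evalMonomial_sub_mem_pow hxK hξ α)
    have h3 := Ideal.mul_mem_mul (evalMonomial_mem_pow hxK α) (hc α)
    rw [← pow_succ, hdeg] at h3
    convert add_mem h2 h3 using 1
    ring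
  have hlow : ∀ e P, (∀ α : σ →₀ ℕ, α.degree < e → P.coeff α = 0) → eval₂Hom ρ ξ P ∈ K ^ e := by
    intro e P hP
    rw [eval₂_eq_sum_prod ρ ξ P subset_rfl]
    refine Ideal.sum_mem _ fun α hα => Ideal.mul_mem_left _ _ ?_
    refine Ideal.pow_le_pow_right ?_ (evalMonomial_mem_pow hξK α)
    by_contra! h
    exact mem_support_iff.1 hα (hP α h)
  refine ⟨?_, ?_, hbot⟩
  -- surjectivity: approximate an element of `Q` modulo higher and higher powers of `K`
  · have happrox : ∀ e q, ∃ P, q - eval₂Hom ρ ξ P ∈ K ^ e := by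
      intro e
      induction e with
      | zero => exact fun q => ⟨0, by simp⟩
      | succ e ih =>
        intro q
        obtain ⟨P₀, hP₀⟩ := ih q
        rw [hK, ← Ideal.map_pow, Ideal.mem_map_iff_of_surjective π hπ] at hP₀
        obtain ⟨a, ha, haq⟩ := hP₀
        rw [hI, Ideal.mem_span_pow_iff_exists_isHomogeneous] at ha
        obtain ⟨P', hP', rfl⟩ := ha
        choose r hr using hsurj
        let P : MvPolynomial σ R := ∑ α ∈ P'.support, monomial α (r (P'.coeff α))
        have hPc : ∀ α, P.coeff α = if α ∈ P'.support then r (P'.coeff α) else 0 := fun α => by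
          simp [P, coeff_sum, coeff_monomial]
        have hP : P.IsHomogeneous e := by
          intro α hα
          refine hP' fun h => hα ?_
          rw [hPc, if_neg (notMem_support_iff.2 h)]
        have := hform e P P' hP hP' fun α => by
          rw [hPc]
          split_ifs with h
          · exact hr _
          · rw [notMem_support_iff.1 h]
            simp
        refine ⟨P₀ + P, ?_⟩
        rw [haq] at this
        rw [map_add]
        convert neg_mem this using 1
        ring
    intro q
    obtain ⟨P, hP⟩ := happrox n q
    rw [hbot] at hP
    exact ⟨P, (sub_eq_zero.1 hP).symm⟩
  · intro e
    induction e with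
    | zero => simp
    | succ e ih =>
      intro he P
      refine ⟨fun h => ?_, hlow _ P⟩
      have hlt := (ih (by omega) P).1 (Ideal.pow_le_pow_right (Nat.le_succ e) h)
      -- the form of degree `e` in `P` is mapped into `K ^ (e + 1)`, so quasi-regularity applies to it
      let H := homogeneousComponent e P
      have hH : H.IsHomogeneous e := homogeneousComponent_isHomogeneous e P
      have h1 : eval₂Hom ρ ξ (P - H) ∈ K ^ (e + 1) := hlow _ _ fun α hα => by
        rw [coeff_sub, coeff_homogeneousComponent]
        split_ifs with h
        · exact sub_self _
        · rw [hlt α (by omega), sub_zero]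
      have h2 : eval₂Hom ρ ξ H ∈ K ^ (e + 1) := by
        have := sub_mem h h1
        rwa [← map_sub, sub_sub_cancel] at this
      choose a ha using fun r => hπ (ρ r)
      let P' : MvPolynomial σ A := ∑ α ∈ H.support, monomial α (a (H.coeff α))
      have hPc : ∀ α, P'.coeff α = if α ∈ H.support then a (H.coeff α) else 0 := fun α => by
        simp [P', coeff_sum, coeff_monomial]
      have hP' : P'.IsHomogeneous e := by
        intro α hα
        refine hH fun h => hα ?_
        rw [hPc, if_neg (notMem_support_iff.2 h)]
      have h3 := hform e H P' hH hP' fun α => by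
        rw [hPc]
        split_ifs with h
        · rw [ha, sub_self]
          exact zero_mem _
        · rw [notMem_support_iff.1 h]
          simp
      have h4 : π (eval x P') ∈ K ^ (e + 1) := by
        have := sub_mem h2 h3
        rwa [sub_sub_cancel] at this
      have h5 := hx e P' hP' ((hmem _ he _).1 h4)
      intro α hα
      rcases Nat.lt_succ_iff_lt_or_eq.1 hα with h | h
      · exact hlt α h
      · by_contra hne
        have hαH : H.coeff α = P.coeff α := by rw [coeff_homogeneousComponent, if_pos h]
        have h6 := h5 α
        rw [hPc, if_pos (mem_support_iff.2 (hαH ▸ hne))] at h6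
        have h7 := Ideal.mem_map_of_mem π h6
        rw [ha, hαH] at h7
        exact hne (hinj _ h7)

end Frames

/-! ### Pulling back germs -/

section Comap

variable {E : Type*} [NormedAddCommGroup E] [NormedSpace ℂ E]
  {X : Type*} [TopologicalSpace X] [ChartedSpace E X]
  {E' : Type*} [NormedAddCommGroup E'] [NormedSpace ℂ E']
  {X' : Type*} [TopologicalSpace X'] [ChartedSpace E' X']

/-- The pullback of germs of holomorphic functions under a map that is holomorphic near `x`. -/
def HolGerm.comap {g : X' → X} {x : X'} (hg : ContMDiffAt 𝓘(ℂ, E') 𝓘(ℂ, E) ω g x) :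
    HolGerm E (g x) →+* HolGerm E' x where
  toFun a := ⟨a.1.compTendsto g hg.continuousAt, by
    obtain ⟨_, f, hf, rfl⟩ := a
    exact ⟨f ∘ g, hf.comp x hg, rfl⟩⟩
  map_one' := rfl
  map_zero' := rfl
  map_add' := by
    rintro ⟨_, f, hf, rfl⟩ ⟨_, f', hf', rfl⟩
    rfl
  map_mul' := by
    rintro ⟨_, f, hf, rfl⟩ ⟨_, f', hf', rfl⟩
    rfl

end Comap

/-! ### The normal bundle in adapted coordinates -/

section NormalBundle

variable {E : Type*} [NormedAddCommGroup E] [NormedSpace ℂ E]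
  {M : Type*} [TopologicalSpace M] [ChartedSpace E M] {m d : ℕ} {S : Submfd E M m d}

/-- The projection of the normal bundle onto the submanifold, as a map to the ambient manifold. -/
def basePoint (n : NormalBundle S) : M := n.1

namespace AdaptedChart

variable (φ : AdaptedChart E S.carrier m d)

theorem bundleMap_of_mem {n : NormalBundle S} (h : (n.1 : M) ∈ φ.toChart.source) :
    φ.bundleMap n = (φ.normalCoord n.1 h n.2, (φ.toChart n.1).2) := dif_pos h

theorem bundleMap_zeroSection {p : S.carrier} (h : (p : M) ∈ φ.toChart.source) :
    φ.bundleMap (zeroSection S p) = φ.toChart p := by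
  rw [φ.bundleMap_of_mem (n := zeroSection S p) h, φ.toChart_eq p h]
  exact Prod.ext (map_zero (φ.normalCoord p h)) rfl

theorem mem_range_zeroSection_iff {n : NormalBundle S} (h : (n.1 : M) ∈ φ.toChart.source) :
    n ∈ range (zeroSection S) ↔ (φ.bundleMap n).1 = 0 := by
  constructor
  · rintro ⟨p, rfl⟩
    rw [φ.bundleMap_zeroSection (p := p) h]
    exact (φ.mem_iff p h).1 p.2
  · intro h0
    obtain ⟨p, v⟩ := n
    rw [φ.bundleMap_of_mem h] at h0
    refine ⟨p, ?_⟩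
    have h1 := φ.normalVec_normalCoord p h v
    have h2 := φ.normalVec_normalCoord p h 0
    rw [show φ.normalCoord p h v = 0 from h0] at h1
    rw [map_zero] at h2
    exact h2.symm.trans h1

theorem openPartialHomeomorph_mem_atlas (p₀ : S.carrier) :
    (normalBundleCore S).openPartialHomeomorph (φ.bundleChart p₀) ⟨φ, p₀, rfl⟩ ∈
      atlas (Model m d) (NormalBundle S) :=
  mem_iUnion₂.2 ⟨φ.bundleChart p₀, ⟨φ, p₀, rfl⟩, rfl⟩

/-- The chart of the normal bundle that is induced by an adapted chart, as a chart adapted to the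
zero section. -/
def bundle (p₀ : S.carrier) : AdaptedChart (Model m d) (range (zeroSection S)) m d where
  toChart := (normalBundleCore S).openPartialHomeomorph (φ.bundleChart p₀) ⟨φ, p₀, rfl⟩
  holo := contMDiffOn_of_mem_maximalAtlas
    (IsManifold.subset_maximalAtlas (φ.openPartialHomeomorph_mem_atlas p₀))
  holo_symm := contMDiffOn_symm_of_mem_maximalAtlas
    (IsManifold.subset_maximalAtlas (φ.openPartialHomeomorph_mem_atlas p₀))
  mem_iff _ hn := φ.mem_range_zeroSection_iff hn

theorem bundle_toChart {p₀ : S.carrier} (n : NormalBundle S) :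
    (φ.bundle p₀).toChart n = φ.bundleMap n := rfl

theorem bundle_coord {p₀ : S.carrier} (i : Fin m) (n : NormalBundle S) :
    (φ.bundle p₀).coord i n = (φ.bundleMap n).1 i := rfl

end AdaptedChart

variable (S) in
theorem exists_adaptedChart (p : S.carrier) :
    ∃ φ : AdaptedChart E S.carrier m d, (p : M) ∈ φ.toChart.source :=
  S.exists_chart p p.2

theorem contMDiffAt_basePoint (p : S.carrier) :
    ContMDiffAt 𝓘(ℂ, Model m d) 𝓘(ℂ, E) ω (basePoint (S := S)) (zeroSection S p) := by
  obtain ⟨φ, hφ⟩ := exists_adaptedChart S p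
  have hs : zeroSection S p ∈ (φ.bundle p).toChart.source := hφ
  let L : Model m d →L[ℂ] Model m d :=
    (ContinuousLinearMap.inr ℂ (Fin m → ℂ) (Fin d → ℂ)).comp
      (ContinuousLinearMap.snd ℂ (Fin m → ℂ) (Fin d → ℂ))
  have h1 : ContMDiffAt 𝓘(ℂ, Model m d) 𝓘(ℂ, Model m d) ω (fun n => L ((φ.bundle p).toChart n))
      (zeroSection S p) := L.contMDiff.contMDiffAt.comp _ ((φ.bundle p).contMDiffAt hs)
  have hL : L ((φ.bundle p).toChart (zeroSection S p)) = φ.toChart p := by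
    rw [φ.bundle_toChart, φ.bundleMap_zeroSection hφ, φ.toChart_eq p hφ]
    rfl
  have h2 : ContMDiffAt 𝓘(ℂ, Model m d) 𝓘(ℂ, E) ω φ.toChart.symm
      (L ((φ.bundle p).toChart (zeroSection S p))) := by
    rw [hL]
    exact φ.contMDiffAt_symm (φ.toChart.map_source hφ)
  refine (h2.comp (zeroSection S p) h1).congr_of_eventuallyEq ?_
  filter_upwards [(φ.bundle p).toChart.open_source.mem_nhds hs] with n hn
  have hn' : (n.1 : M) ∈ φ.toChart.source := hn
  have : L ((φ.bundle p).toChart n) = φ.toChart n.1 := by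
    rw [φ.bundle_toChart, φ.bundleMap_of_mem hn', φ.toChart_eq n.1 hn']
    rfl
  change (n.1 : M) = φ.toChart.symm (L ((φ.bundle p).toChart n))
  rw [this, φ.toChart.left_inv hn']

theorem contMDiffAt_comp_basePoint {p : S.carrier} {f : M → ℂ}
    (hf : ContMDiffAt 𝓘(ℂ, E) 𝓘(ℂ) ω f (p : M)) :
    ContMDiffAt 𝓘(ℂ, Model m d) 𝓘(ℂ) ω (fun y : NormalBundle S => f (basePoint y))
      (zeroSection S p) :=
  ContMDiffAt.comp (g := f) (zeroSection S p) hf (contMDiffAt_basePoint p)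

/-- The pullback of germs by the projection of the normal bundle. -/
def bundleComap (p : S.carrier) : HolGerm E (p : M) →+* HolGerm (Model m d) (zeroSection S p) :=
  HolGerm.comap (contMDiffAt_basePoint p)

theorem bundleComap_germAt {p : S.carrier} {f : M → ℂ}
    (hf : ContMDiffAt 𝓘(ℂ, E) 𝓘(ℂ) ω f (p : M)) :
    bundleComap p (germAt f hf) = germAt (fun y => f (basePoint y)) (contMDiffAt_comp_basePoint hf) :=
  rfl

theorem continuous_zeroSection : Continuous (zeroSection S) := by
  refine continuous_iff_continuousAt.2 fun p => ?_
  obtain ⟨φ, hφ⟩ := exists_adaptedChart S p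
  have hs : zeroSection S p ∈ (φ.bundle p).toChart.source := hφ
  have h1 : ContinuousAt (fun q : S.carrier => φ.toChart q) p :=
    (φ.toChart.continuousAt hφ).comp continuousAt_subtype_val
  have h2 : ContinuousAt (φ.bundle p).toChart.symm (φ.toChart p) := by
    rw [← φ.bundleMap_zeroSection hφ]
    exact (φ.bundle p).toChart.symm.continuousAt ((φ.bundle p).toChart.map_source hs)
  refine (ContinuousAt.comp (f := fun q : S.carrier => φ.toChart q) h2 h1).congr ?_
  filter_upwards [continuousAt_subtype_val.eventually_mem (φ.toChart.open_source.mem_nhds hφ)]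
    with q hq
  change (φ.bundle p).toChart.symm (φ.toChart q) = zeroSection S q
  rw [← φ.bundleMap_zeroSection hq]
  exact (φ.bundle p).toChart.left_inv (show zeroSection S q ∈ (φ.bundle p).toChart.source from hq)

theorem isInducing_zeroSection : Topology.IsInducing (zeroSection S) := by
  refine Topology.isInducing_iff_nhds.2 fun p => le_antisymm ?_ ?_
  · exact (continuous_zeroSection (S := S)).continuousAt.tendsto.le_comap
  · rw [nhds_subtype_eq_comap]
    have h := (contMDiffAt_basePoint p).continuousAt.tendsto.le_comap
    exact (comap_mono h).trans_eq comap_comap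

/-! ### Change of adapted coordinates -/

namespace AdaptedChart

variable (φ : AdaptedChart E S.carrier m d)

/-- The differential of the coordinate `z'_i` of an adapted chart. -/
def coordDiff (x : M) (i : Fin m) : E →L[ℂ] ℂ :=
  ((ContinuousLinearMap.proj i).comp
    (ContinuousLinearMap.fst ℂ (Fin m → ℂ) (Fin d → ℂ))).comp (φ.diff x)

theorem hasMFDerivAt_coord {x : M} (hx : x ∈ φ.toChart.source) (i : Fin m) :
    HasMFDerivAt 𝓘(ℂ, E) 𝓘(ℂ) (φ.coord i) x (φ.coordDiff x i) :=
  HasMFDerivAt.comp x (((ContinuousLinearMap.proj i).comp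
    (ContinuousLinearMap.fst ℂ (Fin m → ℂ) (Fin d → ℂ))).hasMFDerivAt) (φ.hasDiff hx)

theorem hasMFDerivAt_sum_mul {x : M} (hx : x ∈ φ.toChart.source) (hS : x ∈ S.carrier)
    {A : Fin m → M → ℂ} (hA : ∀ j, ContMDiffAt 𝓘(ℂ, E) 𝓘(ℂ) ω (A j) x) (s : Finset (Fin m)) :
    HasMFDerivAt 𝓘(ℂ, E) 𝓘(ℂ) (∑ j ∈ s, A j * φ.coord j) x
      (∑ j ∈ s, A j x • φ.coordDiff x j : E →L[ℂ] ℂ) := by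
  classical
  induction s using Finset.induction_on with
  | empty =>
    simp only [Finset.sum_empty]
    exact hasMFDerivAt_const 0 x
  | insert a s ha ih =>
    rw [Finset.sum_insert ha, Finset.sum_insert ha]
    refine HasMFDerivAt.add ?_ ih
    obtain ⟨A', hA'⟩ : ∃ A' : E →L[ℂ] ℂ, HasMFDerivAt 𝓘(ℂ, E) 𝓘(ℂ) (A a) x A' :=
      ⟨_, ((hA a).mdifferentiableAt (by simp)).hasMFDerivAt⟩
    have h1 : HasMFDerivAt 𝓘(ℂ, E) 𝓘(ℂ) (A a * φ.coord a) x
        (A a x • φ.coordDiff x a + φ.coord a x • A' : E →L[ℂ] ℂ) :=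
      HasMFDerivAt.mul hA' (φ.hasMFDerivAt_coord hx a)
    have h0 : φ.coord a x = 0 := by
      rw [coord, (φ.mem_iff x hx).1 hS]
      rfl
    have h2 : (A a x • φ.coordDiff x a + φ.coord a x • A' : E →L[ℂ] ℂ) =
        A a x • φ.coordDiff x a := by
      rw [h0]
      ext v
      simp
    exact h1.congr_mfderiv h2

theorem bundleMap_fst {n : NormalBundle S} (hn : basePoint n ∈ φ.toChart.source)
    {v : TangentSpace 𝓘(ℂ, E) (n.1 : M)} (hv : Submodule.Quotient.mk v = n.2) (i : Fin m) :
    (φ.bundleMap n).1 i = φ.coordDiff (basePoint n) i v := by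
  rw [φ.bundleMap_of_mem hn, ← hv]
  rfl

/-- The coordinates `z'` of two adapted charts are related by a linear change of coordinates with
holomorphic coefficients, on the ambient manifold and, with the same coefficients, on the normal
bundle. The coefficients are a choice of Hadamard quotients; on the normal bundle the relation
follows by differentiating the one on the ambient manifold at the points of the submanifold, where
the terms with differentials of the coefficients drop out. -/
theorem exists_coordGerm_eq_sum [IsManifold 𝓘(ℂ, E) ω M] {p : S.carrier}
    (hφ : (p : M) ∈ φ.toChart.source)
    (φ' : AdaptedChart E S.carrier m d) (hφ' : (p : M) ∈ φ'.toChart.source) (i : Fin m)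
    (p₀ p₁ : S.carrier) :
    ∃ a : Fin m → HolGerm E (p : M), φ'.coordGerm hφ' i = ∑ j, a j * φ.coordGerm hφ j ∧
      (φ'.bundle p₁).coordGerm (x := zeroSection S p) hφ' i =
        ∑ j, bundleComap p (a j) *
          (φ.bundle p₀).coordGerm (x := zeroSection S p) hφ j := by
  have hmem := φ'.coordGerm_mem hφ' i
  rw [φ.vanIdeal_eq_span hφ p.2, Ideal.mem_span_range_iff_exists_fun] at hmem
  obtain ⟨a, ha⟩ := hmem
  refine ⟨a, ha.symm, ?_⟩
  choose A hA hAa using fun j => exists_germAt (a j)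
  have hsum : germAt (φ'.coord i) (φ'.contMDiffAt_coord hφ' i) =
      germAt (∑ j, A j * φ.coord j)
        (contMDiffAt_finsetSum' fun j _ => (hA j).mul (φ.contMDiffAt_coord hφ j)) := by
    rw [germAt_sum _ fun j => (hA j).mul (φ.contMDiffAt_coord hφ j)]
    refine ha.symm.trans (Finset.sum_congr rfl fun j _ => ?_)
    rw [germAt_mul (hA j) (φ.contMDiffAt_coord hφ j), hAa]
    rfl
  have hπ := contMDiffAt_basePoint p
  have hAπ := fun j => (hA j).comp (zeroSection S p) hπ
  have hcN := fun j => (φ.bundle p₀).contMDiffAt_coord (x := zeroSection S p) hφ j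
  have hsumN : germAt ((φ'.bundle p₁).coord i) ((φ'.bundle p₁).contMDiffAt_coord
      (x := zeroSection S p) hφ' i) = germAt (∑ j, (A j ∘ basePoint) * (φ.bundle p₀).coord j)
        (contMDiffAt_finsetSum' fun j _ => (hAπ j).mul (hcN j)) := by
    rw [germAt_eq_iff]
    have e1 := (germAt_eq_iff.1 hsum).eventuallyEq_nhds
    have e2 := eventually_all.2 fun j => eventually_contMDiffAt (hA j)
    have e3 := φ.toChart.open_source.mem_nhds hφ
    have e4 := φ'.toChart.open_source.mem_nhds hφ'
    filter_upwards [hπ.continuousAt.eventually e1, hπ.continuousAt.eventually e2,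
      hπ.continuousAt.eventually_mem e3, hπ.continuousAt.eventually_mem e4] with n n1 n2 n3 n4
    obtain ⟨v, hv⟩ := Submodule.Quotient.mk_surjective _ n.2
    rw [Finset.sum_apply]
    simp only [Pi.mul_apply, Function.comp_apply, bundle_coord]
    rw [φ'.bundleMap_fst n4 hv]
    simp only [φ.bundleMap_fst n3 hv]
    have h1 := φ'.hasMFDerivAt_coord n4 i
    have h2 := (φ.hasMFDerivAt_sum_mul n3 n.1.2 n2 Finset.univ).congr_of_eventuallyEq n1
    have h3 := DFunLike.congr_fun (hasMFDerivAt_unique h1 h2) v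
    have h4 : ∀ v : E, (∑ j, A j (basePoint n) • φ.coordDiff (basePoint n) j : E →L[ℂ] ℂ) v =
        ∑ j, A j (basePoint n) * φ.coordDiff (basePoint n) j v := fun v => by
      rw [_root_.sum_apply]
      rfl
    exact h3.trans (h4 v)
  refine hsumN.trans ?_
  rw [germAt_sum _ fun j => (hAπ j).mul (hcN j)]
  refine Finset.sum_congr rfl fun j _ => ?_
  rw [germAt_mul (hAπ j) (hcN j), ← hAa]
  rfl

end AdaptedChart

end NormalBundle

/-! ### Sections of the sheaves `𝓞 / I ^ n` -/

section Sections

variable {E : Type*} [NormedAddCommGroup E] [NormedSpace ℂ E]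
  {X : Type*} [TopologicalSpace X] [ChartedSpace E X] {T : Type*} {ι : T → X}

variable (E ι) in
/-- The stalk at `p` of the ideal `I / I ^ n` of `𝓞 / I ^ n`. -/
def Quo.nilIdeal (n : ℕ) (p : T) : Ideal (Quo E ι n p) :=
  (IdealStalk E ι p).map (Quo.mk E ι n p)

theorem Quo.mk_mem_nilIdeal_pow {e n : ℕ} (he : e ≤ n) {p : T} {f : HolGerm E (ι p)} :
    Quo.mk E ι n p f ∈ Quo.nilIdeal E ι n p ^ e ↔ f ∈ IdealStalk E ι p ^ e := by
  rw [Quo.nilIdeal, ← Ideal.map_pow,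
    Ideal.mem_map_iff_of_surjective _ (Quo.mk_surjective n p)]
  constructor
  · rintro ⟨g, hg, hgf⟩
    have h1 : f - g ∈ IdealStalk E ι p ^ n := by
      rw [← Quo.mk_eq_zero_iff, map_sub, hgf, sub_self]
    have := add_mem (Ideal.pow_le_pow_right he h1) hg
    rwa [sub_add_cancel] at this
  · exact fun hf => ⟨f, hf, rfl⟩

theorem Quo.mk_mem_nilIdeal {n : ℕ} (hn : 1 ≤ n) {p : T} {f : HolGerm E (ι p)} :
    Quo.mk E ι n p f ∈ Quo.nilIdeal E ι n p ↔ f ∈ IdealStalk E ι p := by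
  have := Quo.mk_mem_nilIdeal_pow (f := f) hn
  rwa [pow_one, pow_one] at this

theorem Quo.mk_one_eq_zero_iff {p : T} {f : HolGerm E (ι p)} :
    Quo.mk E ι 1 p f = 0 ↔ f ∈ IdealStalk E ι p := by
  rw [Quo.mk_eq_zero_iff, pow_one]

theorem Quo.exists_isClass {n : ℕ} {p : T} (a : Quo E ι n p) : ∃ f : X → ℂ, a.IsClass f := by
  obtain ⟨g, rfl⟩ := Quo.mk_surjective n p a
  obtain ⟨f, hf, rfl⟩ := exists_germAt g
  exact ⟨f, hf, rfl⟩

theorem Quo.IsClass.add {n : ℕ} {p : T} {a b : Quo E ι n p} {f g : X → ℂ} (ha : a.IsClass f)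
    (hb : b.IsClass g) : (a + b).IsClass (f + g) := by
  obtain ⟨hf, rfl⟩ := ha
  obtain ⟨hg, rfl⟩ := hb
  exact ⟨hf.add hg, by rw [germAt_add hf hg, map_add]⟩

theorem Quo.IsClass.mul {n : ℕ} {p : T} {a b : Quo E ι n p} {f g : X → ℂ} (ha : a.IsClass f)
    (hb : b.IsClass g) : (a * b).IsClass (f * g) := by
  obtain ⟨hf, rfl⟩ := ha
  obtain ⟨hg, rfl⟩ := hb
  exact ⟨hf.mul hg, by rw [germAt_mul hf hg, map_mul]⟩

theorem Quo.isClass_zero {n : ℕ} {p : T} : (0 : Quo E ι n p).IsClass (0 : X → ℂ) :=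
  ⟨contMDiffAt_const, (map_zero (Quo.mk E ι n p)).symm⟩

theorem Quo.isClass_one {n : ℕ} {p : T} : (1 : Quo E ι n p).IsClass (1 : X → ℂ) :=
  ⟨contMDiffAt_const, (map_one (Quo.mk E ι n p)).symm⟩

open scoped Classical in
/-- The class `[f]_n` at `q` of a function `f`, or `0` if `f` is not holomorphic near `q`. -/
def Quo.ofFun (n : ℕ) (f : X → ℂ) (q : T) : Quo E ι n q :=
  if h : ContMDiffAt 𝓘(ℂ, E) 𝓘(ℂ) ω f (ι q) then Quo.mk E ι n q (germAt f h) else 0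

theorem Quo.ofFun_eq {n : ℕ} {f : X → ℂ} {q : T} (h : ContMDiffAt 𝓘(ℂ, E) 𝓘(ℂ) ω f (ι q)) :
    (Quo.ofFun n f q : Quo E ι n q) = Quo.mk E ι n q (germAt f h) := dif_pos h

theorem Quo.isClass_ofFun {n : ℕ} {f : X → ℂ} {q : T} (h : ContMDiffAt 𝓘(ℂ, E) 𝓘(ℂ) ω f (ι q)) :
    (Quo.ofFun n f q : Quo E ι n q).IsClass f := ⟨h, Quo.ofFun_eq h⟩

variable [TopologicalSpace T]

theorem germAt_mem_idealStalk_iff (hι : Topology.IsInducing ι) {p : T} {f : X → ℂ}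
    {hf : ContMDiffAt 𝓘(ℂ, E) 𝓘(ℂ) ω f (ι p)} :
    germAt f hf ∈ IdealStalk E ι p ↔ ∀ᶠ q in 𝓝 p, f (ι q) = 0 := by
  rw [germAt_mem_vanIdeal, hι.nhds_eq_comap, eventually_comap]
  refine eventually_congr (Eventually.of_forall fun y => ?_)
  constructor
  · rintro h q rfl
    exact h ⟨q, rfl⟩
  · rintro h ⟨q, rfl⟩
    exact h q rfl

theorem Quo.isSectionNear_ofFun [IsManifold 𝓘(ℂ, E) ω X] {n : ℕ} {f : X → ℂ} {p : T}
    (hι : Continuous ι) (h : ContMDiffAt 𝓘(ℂ, E) 𝓘(ℂ) ω f (ι p)) :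
    Quo.IsSectionNear (fun q => (Quo.ofFun n f q : Quo E ι n q)) p :=
  ⟨f, (hι.continuousAt.eventually (eventually_contMDiffAt h)).mono fun _ hq => Quo.isClass_ofFun hq⟩

theorem Quo.IsSectionNear.congr {n : ℕ} {s t : ∀ q : T, Quo E ι n q} {p : T}
    (hs : Quo.IsSectionNear s p) (h : ∀ᶠ q in 𝓝 p, s q = t q) : Quo.IsSectionNear t p := by
  obtain ⟨f, hf⟩ := hs
  exact ⟨f, by filter_upwards [hf, h] with q h1 h2 using h2 ▸ h1⟩

theorem Quo.IsSectionNear.add {n : ℕ} {s t : ∀ q : T, Quo E ι n q} {p : T}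
    (hs : Quo.IsSectionNear s p) (ht : Quo.IsSectionNear t p) :
    Quo.IsSectionNear (fun q => s q + t q) p := by
  obtain ⟨f, hf⟩ := hs
  obtain ⟨g, hg⟩ := ht
  exact ⟨f + g, by filter_upwards [hf, hg] with q h1 h2 using h1.add h2⟩

theorem Quo.IsSectionNear.mul {n : ℕ} {s t : ∀ q : T, Quo E ι n q} {p : T}
    (hs : Quo.IsSectionNear s p) (ht : Quo.IsSectionNear t p) :
    Quo.IsSectionNear (fun q => s q * t q) p := by
  obtain ⟨f, hf⟩ := hs
  obtain ⟨g, hg⟩ := ht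
  exact ⟨f * g, by filter_upwards [hf, hg] with q h1 h2 using h1.mul h2⟩

theorem Quo.isSectionNear_zero {n : ℕ} {p : T} :
    Quo.IsSectionNear (fun q => (0 : Quo E ι n q)) p :=
  ⟨0, Eventually.of_forall fun _ => Quo.isClass_zero⟩

theorem Quo.isSectionNear_one {n : ℕ} {p : T} :
    Quo.IsSectionNear (fun q => (1 : Quo E ι n q)) p :=
  ⟨1, Eventually.of_forall fun _ => Quo.isClass_one⟩

theorem Quo.IsSectionNear.pow {n : ℕ} {s : ∀ q : T, Quo E ι n q} {p : T}
    (hs : Quo.IsSectionNear s p) (j : ℕ) : Quo.IsSectionNear (fun q => s q ^ j) p := by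
  induction j with
  | zero => simpa only [pow_zero] using Quo.isSectionNear_one
  | succ j ih => simpa only [pow_succ] using ih.mul hs

theorem Quo.isSectionNear_sum {n : ℕ} {κ : Type*} {s : κ → ∀ q : T, Quo E ι n q} {p : T}
    (A : Finset κ) (hs : ∀ i, Quo.IsSectionNear (s i) p) :
    Quo.IsSectionNear (fun q => ∑ i ∈ A, s i q) p := by
  classical
  induction A using Finset.induction_on with
  | empty => simpa only [Finset.sum_empty] using Quo.isSectionNear_zero
  | insert a A ha ih => simpa only [Finset.sum_insert ha] using (hs a).add ih

theorem Quo.isSectionNear_prod {n : ℕ} {κ : Type*} {s : κ → ∀ q : T, Quo E ι n q} {p : T}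
    (A : Finset κ) (hs : ∀ i, Quo.IsSectionNear (s i) p) :
    Quo.IsSectionNear (fun q => ∏ i ∈ A, s i q) p := by
  classical
  induction A using Finset.induction_on with
  | empty => simpa only [Finset.prod_empty] using Quo.isSectionNear_one
  | insert a A ha ih => simpa only [Finset.prod_insert ha] using (hs a).mul ih

/-- Two sections that agree at a point agree near this point. -/
theorem Quo.IsSectionNear.eventually_eq [IsManifold 𝓘(ℂ, E) ω X] (hι : Continuous ι) {n : ℕ}
    {s t : ∀ q : T, Quo E ι n q} {p : T} (hs : Quo.IsSectionNear s p) (ht : Quo.IsSectionNear t p)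
    (h : s p = t p) : ∀ᶠ q in 𝓝 p, s q = t q := by
  obtain ⟨f, hf⟩ := hs
  obtain ⟨g, hg⟩ := ht
  obtain ⟨hf₀, hfs⟩ := hf.self_of_nhds
  obtain ⟨hg₀, hgt⟩ := hg.self_of_nhds
  have h1 : germAt (f - g) (hf₀.sub hg₀) ∈ IdealStalk E ι p ^ n := by
    rw [germAt_sub hf₀ hg₀, ← Quo.mk_eq_zero_iff, map_sub, ← hfs, ← hgt, h, sub_self]
  filter_upwards [hf, hg, hι.continuousAt.eventually (eventually_germAt_mem_pow h1)]
    with q ⟨hfq, hfs⟩ ⟨hgq, hgt⟩ h2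
  rw [hfs, hgt, ← sub_eq_zero, ← map_sub, Quo.mk_eq_zero_iff, ← germAt_sub hfq hgq]
  exact h2 (hfq.sub hgq)

theorem Quo.exists_isSectionNear [IsManifold 𝓘(ℂ, E) ω X] (hι : Continuous ι) {n : ℕ} {p : T}
    (a : Quo E ι n p) : ∃ s : ∀ q : T, Quo E ι n q, s p = a ∧ Quo.IsSectionNear s p := by
  obtain ⟨f, hf, rfl⟩ := a.exists_isClass
  exact ⟨_, Quo.ofFun_eq hf, Quo.isSectionNear_ofFun hι hf⟩

/-! ### Polynomials over the structure sheaf of the submanifold -/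

/-- The family `P` of polynomials over the stalks of the structure sheaf is near `p` a polynomial
whose coefficients are sections. -/
def IsPolySectionNear {σ : Type*} (P : ∀ q : T, MvPolynomial σ (Quo E ι 1 q)) (p : T) : Prop :=
  (∃ A : Finset (σ →₀ ℕ), ∀ᶠ q in 𝓝 p, (P q).support ⊆ A) ∧
    ∀ α, Quo.IsSectionNear (fun q => (P q).coeff α) p

/-- Every polynomial over the stalk at `p` extends to a polynomial whose coefficients are sections near
`p`, without enlarging its support. -/
theorem exists_isPolySectionNear [IsManifold 𝓘(ℂ, E) ω X] (hι : Continuous ι) {σ : Type*} {p : T}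
    (P₀ : MvPolynomial σ (Quo E ι 1 p)) :
    ∃ P : ∀ q : T, MvPolynomial σ (Quo E ι 1 q), P p = P₀ ∧ IsPolySectionNear P p ∧
      ∀ q, (P q).support ⊆ P₀.support := by
  classical
  choose s hs hs' using fun α => Quo.exists_isSectionNear hι (P₀.coeff α)
  let P : ∀ q : T, MvPolynomial σ (Quo E ι 1 q) := fun q =>
    ∑ α ∈ P₀.support, MvPolynomial.monomial α (s α q)
  have hc : ∀ q α, (P q).coeff α = if α ∈ P₀.support then s α q else 0 := fun q α => by
    simp [P, MvPolynomial.coeff_sum, MvPolynomial.coeff_monomial]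
  have hsupp : ∀ q, (P q).support ⊆ P₀.support := fun q α hα => by
    by_contra h
    rw [MvPolynomial.mem_support_iff, hc, if_neg h] at hα
    exact hα rfl
  refine ⟨P, ?_, ⟨⟨_, Eventually.of_forall hsupp⟩, fun α => ?_⟩, hsupp⟩
  · ext α
    rw [hc, hs]
    split_ifs with h
    · rfl
    · exact (MvPolynomial.notMem_support_iff.1 h).symm
  · simp only [hc]
    split_ifs
    · exact hs' α
    · exact Quo.isSectionNear_zero

theorem IsPolySectionNear.eval₂Hom {E' : Type*} [NormedAddCommGroup E'] [NormedSpace ℂ E']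
    {X' : Type*} [TopologicalSpace X'] [ChartedSpace E' X'] {ι' : T → X'} {n : ℕ} {σ : Type*}
    {P : ∀ q : T, MvPolynomial σ (Quo E ι 1 q)} {p : T} (hP : IsPolySectionNear P p)
    {ρ : ∀ q : T, Quo E ι 1 q →+* Quo E' ι' n q}
    (hρ : ∀ s : ∀ q : T, Quo E ι 1 q, Quo.IsSectionNear s p →
      Quo.IsSectionNear (fun q => ρ q (s q)) p)
    {ξ : σ → ∀ q : T, Quo E' ι' n q} (hξ : ∀ i, Quo.IsSectionNear (ξ i) p) :
    Quo.IsSectionNear (fun q => MvPolynomial.eval₂Hom (ρ q) (fun i => ξ i q) (P q)) p := by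
  obtain ⟨⟨A, hA⟩, hc⟩ := hP
  refine (Quo.isSectionNear_sum (s := fun α q => ρ q ((P q).coeff α) *
    ∏ i ∈ α.support, ξ i q ^ α i) A fun α => ?_).congr ?_
  · exact (hρ _ (hc α)).mul (Quo.isSectionNear_prod _ fun i => (hξ i).pow _)
  · filter_upwards [hA] with q hq
    rw [eval₂_eq_sum_prod _ _ _ hq]
    rfl

end Sections

/-! ### The normal bundle: pullback to the infinitesimal neighbourhoods of the zero section -/

section NormalBundle

variable {E : Type*} [NormedAddCommGroup E] [NormedSpace ℂ E]
  {M : Type*} [TopologicalSpace M] [ChartedSpace E M] {m d : ℕ} {S : Submfd E M m d}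

/-- The pullback `𝓞_S → 𝓞_N / I ^ n` by the projection of the normal bundle. -/
def pullback (S : Submfd E M m d) (n : ℕ) (p : S.carrier) :
    Quo E (Subtype.val : S.carrier → M) 1 p →+* Quo (Model m d) (zeroSection S) n p :=
  Ideal.Quotient.lift (IdealStalk E (Subtype.val : S.carrier → M) p ^ 1)
    ((Quo.mk (Model m d) (zeroSection S) n p).comp (bundleComap p))
    fun a ha => by
      rw [pow_one] at ha
      obtain ⟨f, hf, rfl⟩ := exists_germAt a
      have h1 := (germAt_mem_vanIdeal E hf).1 ha
      have h2 : bundleComap p (germAt f hf) =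
          germAt (0 : NormalBundle S → ℂ) contMDiffAt_const := by
        rw [bundleComap_germAt, germAt_eq_iff]
        filter_upwards [(contMDiffAt_basePoint p).continuousAt.eventually h1] with n hn
        exact hn ⟨n.1, rfl⟩
      rw [RingHom.comp_apply, h2]
      exact map_zero _

theorem pullback_mk (n : ℕ) (p : S.carrier) (a : HolGerm E (p : M)) :
    pullback S n p (Quo.mk E (Subtype.val : S.carrier → M) 1 p a) =
      Quo.mk (Model m d) (zeroSection S) n p (bundleComap p a) := rfl

theorem isClass_pullback {n : ℕ} {p : S.carrier}
    {a : Quo E (Subtype.val : S.carrier → M) 1 p} {f : M → ℂ} (ha : a.IsClass f) :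
    (pullback S n p a).IsClass (fun y => f (basePoint y)) := by
  obtain ⟨hf, rfl⟩ := ha
  exact ⟨contMDiffAt_comp_basePoint hf, rfl⟩

theorem isSectionNear_pullback {n : ℕ} {p : S.carrier}
    {s : ∀ q : S.carrier, Quo E (Subtype.val : S.carrier → M) 1 q} (hs : Quo.IsSectionNear s p) :
    Quo.IsSectionNear (fun q => pullback S n q (s q)) p := by
  obtain ⟨f, hf⟩ := hs
  exact ⟨_, hf.mono fun q hq => isClass_pullback hq⟩

theorem eq_zero_of_pullback_mem {n : ℕ} (hn : 1 ≤ n) {p : S.carrier}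
    {r : Quo E (Subtype.val : S.carrier → M) 1 p}
    (hr : pullback S n p r ∈ Quo.nilIdeal (Model m d) (zeroSection S) n p) : r = 0 := by
  obtain ⟨f, hf, rfl⟩ := r.exists_isClass
  rw [pullback_mk, Quo.mk_mem_nilIdeal hn, bundleComap_germAt,
    germAt_mem_idealStalk_iff isInducing_zeroSection] at hr
  rw [Quo.mk_one_eq_zero_iff, germAt_mem_idealStalk_iff Topology.IsInducing.subtypeVal]
  exact hr

/-- Every function on the normal bundle agrees on the zero section with the pullback of a function on
the submanifold. -/
theorem exists_pullback_sub_mem {n : ℕ} (hn : 1 ≤ n) (p : S.carrier)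
    (a : HolGerm (Model m d) (zeroSection S p)) :
    ∃ r, pullback S n p r - Quo.mk (Model m d) (zeroSection S) n p a ∈
      Quo.nilIdeal (Model m d) (zeroSection S) n p := by
  obtain ⟨f, hf, rfl⟩ := exists_germAt a
  obtain ⟨φ, hφ⟩ := exists_adaptedChart S p
  have hs : zeroSection S p ∈ (φ.bundle p).toChart.source := hφ
  let L : Model m d →L[ℂ] Model m d :=
    (ContinuousLinearMap.inr ℂ (Fin m → ℂ) (Fin d → ℂ)).comp
      (ContinuousLinearMap.snd ℂ (Fin m → ℂ) (Fin d → ℂ))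
  have hL : ∀ q : S.carrier, (q : M) ∈ φ.toChart.source → L (φ.toChart q) = φ.toChart q :=
    fun q hq => (φ.toChart_eq q hq).symm
  have h1 := (φ.bundle p).analyticAt_comp_symm hs hf
  rw [φ.bundle_toChart, φ.bundleMap_zeroSection hφ, ← hL p hφ] at h1
  have h2 : ContMDiffAt 𝓘(ℂ, E) 𝓘(ℂ) ω
      (fun x => f ((φ.bundle p).toChart.symm (L (φ.toChart x)))) p :=
    φ.contMDiffAt_comp (F := fun u => f ((φ.bundle p).toChart.symm (L u))) hφ
      (AnalyticAt.comp (f := L) h1 (L.analyticAt _))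
  refine ⟨Quo.mk _ _ 1 p (germAt _ h2), ?_⟩
  rw [pullback_mk, bundleComap_germAt, ← map_sub, Quo.mk_mem_nilIdeal hn,
    ← germAt_sub (contMDiffAt_comp_basePoint h2) hf,
    germAt_mem_idealStalk_iff isInducing_zeroSection]
  filter_upwards [continuousAt_subtype_val.eventually_mem (φ.toChart.open_source.mem_nhds hφ)]
    with q hq
  have h3 : (φ.bundle p).toChart.symm (L (φ.toChart q)) = zeroSection S q := by
    rw [hL q hq, ← φ.bundleMap_zeroSection hq]
    exact (φ.bundle p).toChart.left_inv (show zeroSection S q ∈ (φ.bundle p).toChart.source from hq)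
  exact sub_eq_zero.2 (congrArg f h3)

/-! ### Polynomial presentations of the infinitesimal neighbourhoods -/

/-- Every lifting of the structure sheaf of a submanifold to `𝓞 / I ^ n`, together with liftings of the
classes modulo `I ^ 2` of the coordinates `z'_i`, presents `𝓞 / I ^ n` as a truncated polynomial ring.
-/
theorem AdaptedChart.isFrame_eval₂Hom {X : Type*} [TopologicalSpace X] [ChartedSpace E X]
    [IsManifold 𝓘(ℂ, E) ω X] {T : Type*} {ι : T → X} {Z : Set X} (φ : AdaptedChart E Z m d)
    (hZ : range ι = Z) {p : T}
    (hp : ι p ∈ φ.toChart.source) {n : ℕ} {R : Type*} [CommRing R] {ρ : R →+* Quo E ι n p}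
    (hinj : ∀ r, ρ r ∈ Quo.nilIdeal E ι n p → r = 0)
    (hsurj : ∀ a, ∃ r, ρ r - Quo.mk E ι n p a ∈ Quo.nilIdeal E ι n p)
    {ξ : Fin m → Quo E ι n p}
    (hξ : ∀ i, ξ i - Quo.mk E ι n p (φ.coordGerm hp i) ∈ Quo.nilIdeal E ι n p ^ 2) :
    IsFrame (Quo.nilIdeal E ι n p) n (MvPolynomial.eval₂Hom ρ ξ) := by
  subst hZ
  exact CplxSub.isFrame_eval₂Hom (φ.vanIdeal_eq_span hp (mem_range_self p))
    (fun _ _ hP h α => φ.coeff_mem_vanIdeal hp hP h α) (Quo.mk_surjective n p)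
    (fun _ => Quo.mk_eq_zero_iff) hinj hsurj hξ

/-- The presentation of `𝓞_N / I ^ n` by polynomials in the fibre coordinates over `𝓞_S`. -/
def AdaptedChart.normalFrame (φ : AdaptedChart E S.carrier m d) (n : ℕ) (p : S.carrier) :
    MvPolynomial (Fin m) (Quo E (Subtype.val : S.carrier → M) 1 p) →+*
      Quo (Model m d) (zeroSection S) n p :=
  MvPolynomial.eval₂Hom (pullback S n p) fun i => Quo.ofFun n (fun y => (φ.bundleMap y).1 i) p

theorem AdaptedChart.ofFun_bundleMap (φ : AdaptedChart E S.carrier m d) (n : ℕ)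
    {p : S.carrier} (hp : (p : M) ∈ φ.toChart.source) (i : Fin m) :
    Quo.ofFun n (fun y => (φ.bundleMap y).1 i) p =
      Quo.mk (Model m d) (zeroSection S) n p
        ((φ.bundle p).coordGerm (x := zeroSection S p) hp i) :=
  Quo.ofFun_eq ((φ.bundle p).contMDiffAt_coord (x := zeroSection S p) hp i)

theorem AdaptedChart.isFrame_normalFrame (φ : AdaptedChart E S.carrier m d) {n : ℕ} (hn : 1 ≤ n)
    {p : S.carrier} (hp : (p : M) ∈ φ.toChart.source) :
    IsFrame (Quo.nilIdeal (Model m d) (zeroSection S) n p) n (φ.normalFrame n p) :=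
  (φ.bundle p).isFrame_eval₂Hom rfl (p := p) hp (fun _ => eq_zero_of_pullback_mem hn)
    (exists_pullback_sub_mem hn p) fun i =>
      (congrArg (· ∈ Quo.nilIdeal (Model m d) (zeroSection S) n p ^ 2)
        (sub_eq_zero.2 (φ.ofFun_bundleMap n hp i))).mpr (zero_mem _)

theorem AdaptedChart.isSectionNear_normalFrame (φ : AdaptedChart E S.carrier m d) {n : ℕ}
    {p : S.carrier} (hp : (p : M) ∈ φ.toChart.source)
    {P : ∀ q : S.carrier, MvPolynomial (Fin m) (Quo E (Subtype.val : S.carrier → M) 1 q)}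
    (hP : IsPolySectionNear P p) :
    Quo.IsSectionNear (fun q => φ.normalFrame n q (P q)) p :=
  hP.eval₂Hom (fun _ hs => isSectionNear_pullback hs) fun i =>
    Quo.isSectionNear_ofFun continuous_zeroSection
      ((φ.bundle p).contMDiffAt_coord (x := zeroSection S p) hp i)

/-- The linear substitution `X_i ↦ ∑_j a_{ij} X_j` of polynomials. -/
def linSubst {R σ : Type*} [CommRing R] [Fintype σ] (a : σ → σ → R) :
    MvPolynomial σ R →+* MvPolynomial σ R :=
  MvPolynomial.eval₂Hom MvPolynomial.C fun i => ∑ j, MvPolynomial.C (a i j) * MvPolynomial.X j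

theorem totalDegree_linSubst_le {R σ : Type*} [CommRing R] [Fintype σ] (a : σ → σ → R)
    (P : MvPolynomial σ R) : (linSubst a P).totalDegree ≤ P.totalDegree := by
  conv_lhs => rw [← MvPolynomial.sum_homogeneousComponent P, map_sum]
  refine MvPolynomial.totalDegree_finsetSum_le fun e he => ?_
  have h1 := (MvPolynomial.homogeneousComponent_isHomogeneous e P).eval₂ MvPolynomial.C
    (fun i => ∑ j, MvPolynomial.C (a i j) * MvPolynomial.X j)
    (fun r => MvPolynomial.isHomogeneous_C _ r)
    (fun i => MvPolynomial.IsHomogeneous.sum _ _ 1 fun j _ =>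
      MvPolynomial.isHomogeneous_C_mul_X (a i j) j)
  rw [one_mul] at h1
  exact h1.totalDegree_le.trans (Nat.lt_succ_iff.1 (Finset.mem_range.1 he))

theorem eval₂Hom_comp_linSubst {R Q σ : Type*} [CommRing R] [CommRing Q] [Fintype σ]
    (a : σ → σ → R) (ρ : R →+* Q) (ξ ξ' : σ → Q) (h : ∀ i, ξ' i = ∑ j, ρ (a i j) * ξ j) :
    MvPolynomial.eval₂Hom ρ ξ' = (MvPolynomial.eval₂Hom ρ ξ).comp (linSubst a) := by
  refine MvPolynomial.ringHom_ext (fun r => ?_) fun i => ?_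
  · simp [linSubst]
  · simp [linSubst, h]

/-- Two adapted charts at `p` are related by a matrix `a` of germs on the ambient manifold which also
relates the presentations of the infinitesimal neighbourhoods of the zero section. -/
theorem AdaptedChart.exists_normalFrame_eq [IsManifold 𝓘(ℂ, E) ω M]
    (φ φ' : AdaptedChart E S.carrier m d) (n : ℕ) {p : S.carrier}
    (hφ : (p : M) ∈ φ.toChart.source) (hφ' : (p : M) ∈ φ'.toChart.source) :
    ∃ a : Fin m → Fin m → HolGerm E (p : M),
      (∀ i, φ'.coordGerm hφ' i = ∑ j, a i j * φ.coordGerm hφ j) ∧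
      φ'.normalFrame n p = (φ.normalFrame n p).comp
        (linSubst fun i j => Quo.mk E (Subtype.val : S.carrier → M) 1 p (a i j)) := by
  choose a ha ha' using fun i => φ.exists_coordGerm_eq_sum hφ φ' hφ' i p p
  refine ⟨a, ha, eval₂Hom_comp_linSubst _ _ _ _ fun i => ?_⟩
  rw [φ'.ofFun_bundleMap n hφ', ha', map_sum]
  refine Finset.sum_congr rfl fun j _ => ?_
  rw [map_mul, φ.ofFun_bundleMap n hφ, pullback_mk]

end NormalBundle

/-! ### From presentations by polynomials to comfortable embeddings -/

section Truncation

open MvPolynomial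

variable {R σ : Type*} [CommRing R]

theorem eq_zero_of_totalDegree_le {P : MvPolynomial σ R} {j : ℕ} (h : P.totalDegree ≤ j)
    (h' : ∀ α : σ →₀ ℕ, α.degree < j + 1 → P.coeff α = 0) : P = 0 := by
  ext α
  rw [coeff_zero]
  by_cases hα : α.degree < j + 1
  · exact h' α hα
  · refine coeff_eq_zero_of_totalDegree_lt (h.trans_lt ?_)
    change j < α.degree
    omega

/-- Truncation of a polynomial at degree `j`. -/
theorem exists_totalDegree_le (P : MvPolynomial σ R) (j : ℕ) : ∃ P' : MvPolynomial σ R,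
    P'.totalDegree ≤ j ∧ ∀ α : σ →₀ ℕ, α.degree < j + 1 → (P - P').coeff α = 0 := by
  refine ⟨∑ e ∈ Finset.range (j + 1), homogeneousComponent e P, ?_, fun α hα => ?_⟩
  · refine totalDegree_finsetSum_le fun e he => ?_
    exact (homogeneousComponent_isHomogeneous e P).totalDegree_le.trans
      (Nat.lt_succ_iff.1 (Finset.mem_range.1 he))
  · rw [coeff_sub, coeff_sum]
    simp only [coeff_homogeneousComponent]
    rw [Finset.sum_ite_eq, if_pos (Finset.mem_range.2 hα), sub_self]

end Truncation

section Lifting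

variable {E : Type*} [NormedAddCommGroup E] [NormedSpace ℂ E]
  {X : Type*} [TopologicalSpace X] [ChartedSpace E X] {T : Type*} [TopologicalSpace T] {ι : T → X}

theorem Lifting.act_induced_mk {k h e : ℕ} (ρ : Lifting E ι k) (hk : h ≤ k) (he : e ≤ h + 1) {p : T}
    {v : Quo E ι 1 p} {a : HolGerm E (ι p)} (ha : ρ.toHom p v = Quo.mk E ι (k + 1) p a)
    (x : IdealStalk E ι p) :
    (ρ.induced hk).act he v (Nil.mk E ι e p x) = Nil.mk E ι e p (a • x) := by
  have h1 : (ρ.induced hk).toHom p v = Quo.mk E ι (h + 1) p a :=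
    congrArg (Quo.proj E ι (Nat.succ_le_succ hk) p) ha
  rw [Lifting.act, h1, Quo.proj_mk, Nil.mk_smul_mk]

theorem Lifting.mk_one_eq {k : ℕ} (ρ : Lifting E ι k) {p : T} {v : Quo E ι 1 p}
    {a : HolGerm E (ι p)} (ha : ρ.toHom p v = Quo.mk E ι (k + 1) p a) : Quo.mk E ι 1 p a = v := by
  have h1 := ρ.proj_toHom p v
  rwa [ha, Quo.proj_mk] at h1

end Lifting

section Comfortable

variable {E : Type*} [NormedAddCommGroup E] [NormedSpace ℂ E]
  {M : Type*} [TopologicalSpace M] [ChartedSpace E M] {m d : ℕ} {S : Submfd E M m d}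

variable (S) in
/-- A system of presentations of the sheaf `𝓞_M / I ^ n` by truncated polynomials over `𝓞_S`, one for
every adapted chart, which are related by linear substitutions. -/
structure FrameSystem (n : ℕ) where
  /-- the presentation at `p` -/
  frame : ∀ (_ : AdaptedChart E S.carrier m d) (p : S.carrier),
    MvPolynomial (Fin m) (Quo E (Subtype.val : S.carrier → M) 1 p) →+*
      Quo E (Subtype.val : S.carrier → M) n p
  isFrame : ∀ (φ : AdaptedChart E S.carrier m d) (p : S.carrier), (p : M) ∈ φ.toChart.source →
    IsFrame (Quo.nilIdeal E (Subtype.val : S.carrier → M) n p) n (frame φ p)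
  isSectionNear : ∀ (φ : AdaptedChart E S.carrier m d) (p : S.carrier), (p : M) ∈ φ.toChart.source →
    ∀ P : ∀ q : S.carrier, MvPolynomial (Fin m) (Quo E (Subtype.val : S.carrier → M) 1 q),
    IsPolySectionNear P p → Quo.IsSectionNear (fun q => frame φ q (P q)) p
  exists_linSubst : ∀ (φ φ' : AdaptedChart E S.carrier m d) (p : S.carrier),
    (p : M) ∈ φ.toChart.source → (p : M) ∈ φ'.toChart.source →
    ∃ a, frame φ' p = (frame φ p).comp (linSubst a)

namespace FrameSystem

variable {n : ℕ} (F : FrameSystem S n)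

/-- The element `w` of `I / I ^ (j + 2)` is the class of a polynomial of degree at most `j`. -/
def IsPoly (j : ℕ) {p : S.carrier} (w : Nil E (Subtype.val : S.carrier → M) (j + 1) p) : Prop :=
  ∃ (φ : AdaptedChart E S.carrier m d)
    (P : MvPolynomial (Fin m) (Quo E (Subtype.val : S.carrier → M) 1 p))
    (x : IdealStalk E (Subtype.val : S.carrier → M) p), (p : M) ∈ φ.toChart.source ∧
    P.totalDegree ≤ j ∧ F.frame φ p P = Quo.mk E (Subtype.val : S.carrier → M) n p x ∧
    w = Nil.mk E (Subtype.val : S.carrier → M) (j + 1) p x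

variable {F} {j : ℕ} {p : S.carrier} {w w' : Nil E (Subtype.val : S.carrier → M) (j + 1) p}

theorem IsPoly.exists_of_chart (h : F.IsPoly j w) (φ : AdaptedChart E S.carrier m d)
    (hφ : (p : M) ∈ φ.toChart.source) :
    ∃ (P : MvPolynomial (Fin m) (Quo E (Subtype.val : S.carrier → M) 1 p))
      (x : IdealStalk E (Subtype.val : S.carrier → M) p), P.totalDegree ≤ j ∧
      F.frame φ p P = Quo.mk E (Subtype.val : S.carrier → M) n p x ∧
      w = Nil.mk E (Subtype.val : S.carrier → M) (j + 1) p x := by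
  obtain ⟨φ', P, x, hφ', hP, hx, hw⟩ := h
  obtain ⟨a, ha⟩ := F.exists_linSubst φ φ' p hφ hφ'
  exact ⟨linSubst a P, x, (totalDegree_linSubst_le a P).trans hP, by rw [← hx, ha]; rfl, hw⟩

theorem IsPoly.add (h : F.IsPoly j w) (h' : F.IsPoly j w') : F.IsPoly j (w + w') := by
  obtain ⟨φ, hφ⟩ := exists_adaptedChart S p
  obtain ⟨P, x, hP, hx, rfl⟩ := h.exists_of_chart φ hφ
  obtain ⟨P', x', hP', hx', rfl⟩ := h'.exists_of_chart φ hφ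
  refine ⟨φ, P + P', x + x', hφ, (MvPolynomial.totalDegree_add P P').trans (max_le hP hP'), ?_, ?_⟩
  · rw [map_add, hx, hx', ← map_add]
    rfl
  · rw [map_add]

/-- A class of a polynomial of degree at most `j` is determined by its image in `I / I ^ (j + 1)`. -/
theorem IsPoly.eq_of_proj_eq (hj : j + 2 ≤ n) (h : F.IsPoly j w) (h' : F.IsPoly j w')
    (hw : Nil.proj E (Subtype.val : S.carrier → M) j p w =
      Nil.proj E (Subtype.val : S.carrier → M) j p w') : w = w' := by
  obtain ⟨φ, hφ⟩ := exists_adaptedChart S p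
  obtain ⟨P, x, hP, hx, rfl⟩ := h.exists_of_chart φ hφ
  obtain ⟨P', x', hP', hx', rfl⟩ := h'.exists_of_chart φ hφ
  have h1 : F.frame φ p (P - P') =
      Quo.mk E (Subtype.val : S.carrier → M) n p ((x - x' : IdealStalk E _ p) : HolGerm E (p : M)) := by
    rw [map_sub, hx, hx', ← map_sub]
    rfl
  rw [Nil.proj_mk, Nil.proj_mk, ← sub_eq_zero, ← map_sub, Nil.mk_eq_zero_iff,
    ← Quo.mk_mem_nilIdeal_pow (by omega : j + 1 ≤ n), ← h1,
    (F.isFrame φ p hφ).mem_pow_iff _ (by omega)] at hw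
  have h2 : P - P' = 0 :=
    eq_zero_of_totalDegree_le ((MvPolynomial.totalDegree_sub P P').trans (max_le hP hP')) hw
  rw [h2, map_zero] at h1
  rw [← sub_eq_zero, ← map_sub, Nil.mk_eq_zero_iff]
  exact Ideal.pow_le_pow_right hj (Quo.mk_eq_zero_iff.1 h1.symm)

variable (F) in
theorem exists_isPoly (hj : j + 2 ≤ n) (u : Nil E (Subtype.val : S.carrier → M) j p) :
    ∃ w, F.IsPoly j w ∧ Nil.proj E (Subtype.val : S.carrier → M) j p w = u := by
  obtain ⟨φ, hφ⟩ := exists_adaptedChart S p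
  obtain ⟨x, rfl⟩ := Nil.mk_surjective j p u
  obtain ⟨P, hP⟩ := (F.isFrame φ p hφ).surjective (Quo.mk E (Subtype.val : S.carrier → M) n p x)
  obtain ⟨P', hP', hPP'⟩ := exists_totalDegree_le P j
  obtain ⟨y, hy⟩ := Quo.mk_surjective n p (F.frame φ p P')
  have h1 : (x : HolGerm E (p : M)) - y ∈ IdealStalk E (Subtype.val : S.carrier → M) p ^ (j + 1) := by
    rw [← Quo.mk_mem_nilIdeal_pow (by omega : j + 1 ≤ n), map_sub, hy, ← hP, ← map_sub,
      (F.isFrame φ p hφ).mem_pow_iff _ (by omega)]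
    exact hPP'
  have hyI : y ∈ IdealStalk E (Subtype.val : S.carrier → M) p := by
    have := sub_mem x.2 (Ideal.pow_le_self (by omega) h1)
    rwa [sub_sub_cancel] at this
  refine ⟨_, ⟨φ, P', ⟨y, hyI⟩, hφ, hP', hy.symm, rfl⟩, ?_⟩
  rw [Nil.proj_mk, eq_comm, ← sub_eq_zero, ← map_sub, Nil.mk_eq_zero_iff]
  exact h1

theorem IsPoly.act {k : ℕ} {ρ : S.Lifting (k + 1)} {F : FrameSystem S (k + 2)}
    (hF : ∀ φ (p : S.carrier) r, (p : M) ∈ φ.toChart.source →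
      F.frame φ p (MvPolynomial.C r) = ρ.toHom p r)
    {j : ℕ} (hj : j + 1 ≤ k + 1) {w : Nil E (Subtype.val : S.carrier → M) (j + 1) p}
    (h : F.IsPoly j w) (v : Quo E (Subtype.val : S.carrier → M) 1 p) :
    F.IsPoly j ((ρ.induced k.le_succ).act hj v w) := by
  obtain ⟨φ, hφ⟩ := exists_adaptedChart S p
  obtain ⟨P, x, hP, hx, rfl⟩ := h.exists_of_chart φ hφ
  obtain ⟨a, ha⟩ := Quo.mk_surjective _ p (ρ.toHom p v)
  refine ⟨φ, MvPolynomial.C v * P, a • x, hφ, ?_, ?_, ρ.act_induced_mk k.le_succ hj ha.symm x⟩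
  · refine (MvPolynomial.totalDegree_mul _ _).trans ?_
    rwa [MvPolynomial.totalDegree_C, zero_add]
  · rw [map_mul, hF φ p v hφ, ← ha, hx, ← map_mul]
    rfl

/-- The splitting `I / I ^ (j + 1) → I / I ^ (j + 2)` given by the polynomials of degree at most
`j`. -/
def split (F : FrameSystem S n) (hj : j + 2 ≤ n) (p : S.carrier) :
    Nil E (Subtype.val : S.carrier → M) j p →+ Nil E (Subtype.val : S.carrier → M) (j + 1) p :=
  AddMonoidHom.mk' (fun u => (F.exists_isPoly hj u).choose) fun u u' => by
    refine (F.exists_isPoly hj (u + u')).choose_spec.1.eq_of_proj_eq hj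
      ((F.exists_isPoly hj u).choose_spec.1.add (F.exists_isPoly hj u').choose_spec.1) ?_
    rw [map_add, (F.exists_isPoly hj (u + u')).choose_spec.2, (F.exists_isPoly hj u).choose_spec.2,
      (F.exists_isPoly hj u').choose_spec.2]

theorem isPoly_split (hj : j + 2 ≤ n) (u : Nil E (Subtype.val : S.carrier → M) j p) :
    F.IsPoly j (F.split hj p u) := (F.exists_isPoly hj u).choose_spec.1

theorem proj_split (hj : j + 2 ≤ n) (u : Nil E (Subtype.val : S.carrier → M) j p) :
    Nil.proj E (Subtype.val : S.carrier → M) j p (F.split hj p u) = u :=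
  (F.exists_isPoly hj u).choose_spec.2

theorem isSectionNear_split [IsManifold 𝓘(ℂ, E) ω M] (hj : j + 2 ≤ n)
    {s : ∀ q : S.carrier, Nil E (Subtype.val : S.carrier → M) j q} (hs : Nil.IsSectionNear s p) :
    Nil.IsSectionNear (fun q => F.split hj q (s q)) p := by
  obtain ⟨φ, hφ⟩ := exists_adaptedChart S p
  obtain ⟨f, hf⟩ := hs
  obtain ⟨hfp, hfI, hfs⟩ := hf.self_of_nhds
  obtain ⟨P₀, x₀, hP₀, hx₀, hw⟩ := (F.isPoly_split hj (s p)).exists_of_chart φ hφ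
  -- the splitting is given near `p` by extending the polynomial at `p` to nearby points
  obtain ⟨P, rfl, hP, hsupp⟩ := exists_isPolySectionNear continuous_subtype_val P₀
  obtain ⟨g, hg⟩ := F.isSectionNear φ p hφ P hP
  obtain ⟨hgp, hgs⟩ := hg.self_of_nhds
  have h1 : germAt g hgp - x₀ ∈ IdealStalk E (Subtype.val : S.carrier → M) p ^ n := by
    rw [← Quo.mk_eq_zero_iff, map_sub, ← hgs, sub_eq_zero]
    exact hx₀
  have h2 : (x₀ : HolGerm E (p : M)) - germAt f hfp ∈
      IdealStalk E (Subtype.val : S.carrier → M) p ^ (j + 1) := by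
    have := F.proj_split hj (s p)
    rw [hw, hfs, Nil.proj_mk, ← sub_eq_zero, ← map_sub, Nil.mk_eq_zero_iff] at this
    exact this
  have h3 : germAt (g - f) (hgp.sub hfp) ∈
      IdealStalk E (Subtype.val : S.carrier → M) p ^ (j + 1) := by
    have := add_mem (Ideal.pow_le_pow_right (by omega) h1) h2
    rwa [sub_add_sub_cancel] at this
  refine ⟨g, ?_⟩
  filter_upwards [hf, hg, continuousAt_subtype_val.eventually (eventually_germAt_mem_pow h3),
    continuousAt_subtype_val.eventually_mem (φ.toChart.open_source.mem_nhds hφ)]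
    with q ⟨hfq, hfqI, hfqs⟩ ⟨hgq, hgqs⟩ hgf hq
  have h4 := hgf (hgq.sub hfq)
  rw [germAt_sub hgq hfq] at h4
  have hgI : germAt g hgq ∈ IdealStalk E (Subtype.val : S.carrier → M) q := by
    have := add_mem (Ideal.pow_le_self (by omega) h4) hfqI
    rwa [sub_add_cancel] at this
  refine ⟨hgq, hgI, ?_⟩
  refine (F.isPoly_split hj (s q)).eq_of_proj_eq hj ⟨φ, P q, _, hq, ?_, hgqs, rfl⟩ ?_
  · exact (Finset.sup_mono (hsupp q)).trans hP₀
  · rw [F.proj_split hj, hfqs, Nil.proj_mk, eq_comm, ← sub_eq_zero, ← map_sub, Nil.mk_eq_zero_iff]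
    exact h4

/-- If the infinitesimal neighbourhood is presented by polynomials over `𝓞_S`, then the polynomials of
degree at most `j` split the projections `I / I ^ (j + 2) → I / I ^ (j + 1)`. -/
theorem isComfortable [IsManifold 𝓘(ℂ, E) ω M] {k : ℕ} (ρ : S.Lifting (k + 1))
    (F : FrameSystem S (k + 2))
    (hF : ∀ φ (p : S.carrier) r, (p : M) ∈ φ.toChart.source →
      F.frame φ p (MvPolynomial.C r) = ρ.toHom p r) :
    (ρ.induced k.le_succ).IsComfortable := by
  refine ⟨fun j p => if hj : j + 2 ≤ k + 2 then F.split hj p else 0, fun j hj => ?_⟩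
  have hj' : j + 2 ≤ k + 2 := by omega
  simp only [dif_pos hj']
  refine ⟨fun s p hs => isSectionNear_split hj' hs, fun p u => proj_split hj' u, fun p v u => ?_⟩
  refine (isPoly_split hj' _).eq_of_proj_eq hj'
    (IsPoly.act hF (Nat.succ_le_succ hj) (isPoly_split hj' u) v) ?_
  rw [proj_split]
  obtain ⟨a, ha⟩ := Quo.mk_surjective _ p (ρ.toHom p v)
  obtain ⟨x, hx⟩ := Nil.mk_surjective (j + 1) p (F.split hj' p u)
  have hu : u = Nil.mk E (Subtype.val : S.carrier → M) j p x := by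
    rw [← F.proj_split hj' u, ← hx, Nil.proj_mk]
  rw [← hx, ρ.act_induced_mk k.le_succ (Nat.succ_le_succ hj) ha.symm, Nil.proj_mk, hu,
    ρ.act_induced_mk k.le_succ _ ha.symm]

end FrameSystem

end Comfortable

/-! ### Linearizable submanifolds are comfortably embedded -/

section Linearizable

variable {E : Type*} [NormedAddCommGroup E] [NormedSpace ℂ E]
  {M : Type*} [TopologicalSpace M] [ChartedSpace E M] [IsManifold 𝓘(ℂ, E) ω M]
  {m d : ℕ} {S : Submfd E M m d}

/-- An isomorphism `ψ` from the infinitesimal neighbourhood of the zero section transports the pullback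
`𝓞_S → 𝓞_N / I ^ (k + 2)` to a lifting, and the presentations by polynomials in the fibre coordinates
to presentations for `M`. -/
theorem exists_isComfortable_of_isLinearizable {k : ℕ} (h : S.IsLinearizable (k + 1)) :
    ∃ ρ : S.Lifting (k + 1), (ρ.induced k.le_succ).IsComfortable := by
  obtain ⟨ψ, hψ, -, hψS⟩ := h
  have hnil : ∀ (p : S.carrier) a,
      ψ p a ∈ Quo.nilIdeal E (Subtype.val : S.carrier → M) (k + 2) p ↔
        a ∈ Quo.nilIdeal (Model m d) (zeroSection S) (k + 2) p := by
    intro p a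
    obtain ⟨f', hf'⟩ := a.exists_isClass
    obtain ⟨f, hf⟩ := (ψ p a).exists_isClass
    have hff := hψS p a f' f hf' hf
    obtain ⟨hf₀, hf₁⟩ := hf
    obtain ⟨hf₀', hf₁'⟩ := hf'
    rw [hf₁, hf₁', Quo.mk_mem_nilIdeal (by omega), Quo.mk_mem_nilIdeal (by omega),
      germAt_mem_idealStalk_iff Topology.IsInducing.subtypeVal,
      germAt_mem_idealStalk_iff isInducing_zeroSection]
    exact eventually_congr (hff.mono fun q hq => by rw [hq])
  let ρ : S.Lifting (k + 1) :=
    { toHom := fun p => ((ψ p : _ →+* _)).comp (pullback S (k + 2) p)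
      map_section := fun s p hs => hψ _ p (isSectionNear_pullback hs)
      proj_toHom := fun p v => by
        obtain ⟨f, hf⟩ := v.exists_isClass
        have hf' := isClass_pullback (n := k + 2) hf
        obtain ⟨g, hg⟩ := (ψ p (pullback S (k + 2) p v)).exists_isClass
        have hfg := hψS p _ _ g hf' hg
        obtain ⟨hf₀, rfl⟩ := hf
        obtain ⟨hg₀, hg₁⟩ := hg
        refine (congrArg (Quo.proj E _ _ p) hg₁).trans ?_
        rw [Quo.proj_mk, ← sub_eq_zero, ← map_sub, Quo.mk_one_eq_zero_iff, ← germAt_sub hg₀ hf₀,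
          germAt_mem_idealStalk_iff Topology.IsInducing.subtypeVal]
        exact hfg.mono fun q hq => sub_eq_zero.2 hq.symm }
  let F : FrameSystem S (k + 2) :=
    { frame := fun φ p => ((ψ p : _ →+* _)).comp (φ.normalFrame (k + 2) p)
      isFrame := fun φ p hφ => (φ.isFrame_normalFrame (by omega) hφ).comp_ringEquiv (ψ p) (hnil p)
      isSectionNear := fun φ p hφ P hP => hψ _ p (φ.isSectionNear_normalFrame hφ hP)
      exists_linSubst := fun φ φ' p hφ hφ' => by
        obtain ⟨a, -, ha⟩ := φ.exists_normalFrame_eq φ' (k + 2) hφ hφ'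
        exact ⟨_, by rw [ha, RingHom.comp_assoc]⟩ }
  refine ⟨ρ, F.isComfortable ρ fun φ p r _ => ?_⟩
  exact congrArg (ψ p) (MvPolynomial.eval₂Hom_C _ _ r)

end Linearizable

/-! ### Lifting the conormal sheaf along a comfortable splitting sequence -/

section Conormal

variable {E : Type*} [NormedAddCommGroup E] [NormedSpace ℂ E]
  {X : Type*} [TopologicalSpace X] [ChartedSpace E X] {T : Type*} {ι : T → X}

/-- The inclusion of `I / I ^ (e + 1)` into `𝓞 / I ^ (e + 1)`. -/
def Nil.toQuo {e : ℕ} {p : T} (u : Nil E ι e p) : Quo E ι (e + 1) p :=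
  Quo.mk E ι (e + 1) p (Nil.mk_surjective e p u).choose

theorem Nil.toQuo_mk {e : ℕ} {p : T} (x : IdealStalk E ι p) :
    (Nil.mk E ι e p x).toQuo = Quo.mk E ι (e + 1) p x := by
  have h := (Nil.mk_surjective e p (Nil.mk E ι e p x)).choose_spec
  rw [Nil.toQuo, ← sub_eq_zero, ← map_sub, Quo.mk_eq_zero_iff]
  rwa [← sub_eq_zero, ← map_sub, Nil.mk_eq_zero_iff] at h

theorem Nil.toQuo_add {e : ℕ} {p : T} (u v : Nil E ι e p) : (u + v).toQuo = u.toQuo + v.toQuo := by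
  obtain ⟨x, rfl⟩ := Nil.mk_surjective e p u
  obtain ⟨y, rfl⟩ := Nil.mk_surjective e p v
  rw [← map_add, Nil.toQuo_mk, Nil.toQuo_mk, Nil.toQuo_mk, ← map_add]
  rfl

variable [TopologicalSpace T]

theorem Nil.isSectionNear_toQuo {e : ℕ} {p : T} {s : ∀ q : T, Nil E ι e q}
    (hs : Nil.IsSectionNear s p) : Quo.IsSectionNear (fun q => (s q).toQuo) p := by
  obtain ⟨f, hf⟩ := hs
  refine ⟨f, hf.mono fun q ⟨hfq, hfI, hfs⟩ => ⟨hfq, ?_⟩⟩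
  beta_reduce
  rw [hfs, Nil.toQuo_mk]

/-- On `I / I ^ 2` the action induced by a lifting is the canonical one. -/
theorem Lifting.act_zero {k : ℕ} (ρ : Lifting E ι k) {p : T} (a : HolGerm E (ι p))
    (x : IdealStalk E ι p) :
    ρ.act (Nat.le_add_left 1 k) (Quo.mk E ι 1 p a) (Nil.mk E ι 1 p x) = Nil.mk E ι 1 p (a • x) := by
  rw [Lifting.act, ρ.proj_toHom, Nil.mk_smul_mk]

/-- For a comfortable embedding the classes of `I / I ^ 2` lift to `I / I ^ (k + 2)`, by a morphism of
sheaves that is linear over the structure sheaf of the submanifold: compose the splittings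
`I / I ^ 2 → I / I ^ 3 → ⋯ → I / I ^ (k + 2)`. -/
theorem exists_conormal_lift {k : ℕ} {ρ : Lifting E ι (k + 1)}
    (h : (ρ.induced k.le_succ).IsComfortable) :
    ∃ κ : ∀ p : T, Nil E ι 1 p → Quo E ι (k + 2) p,
      (∀ (s : ∀ q : T, Nil E ι 1 q) (p : T), Nil.IsSectionNear s p →
        Quo.IsSectionNear (fun q => κ q (s q)) p) ∧
      (∀ p u v, κ p (u + v) = κ p u + κ p v) ∧
      (∀ (p : T) (a : HolGerm E (ι p)) (x : IdealStalk E ι p),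
        κ p (Nil.mk E ι 1 p (a • x)) = ρ.toHom p (Quo.mk E ι 1 p a) * κ p (Nil.mk E ι 1 p x)) ∧
      (∀ (p : T) (x : IdealStalk E ι p), κ p (Nil.mk E ι 1 p x) - Quo.mk E ι (k + 2) p x ∈
        Quo.nilIdeal E ι (k + 2) p ^ 2) := by
  obtain ⟨ν, hν⟩ := h
  have key : ∀ j : ℕ, j ≤ k → ∃ σ : ∀ p : T, Nil E ι 1 p →+ Nil E ι (j + 1) p,
      (∀ (s : ∀ q : T, Nil E ι 1 q) (p : T), Nil.IsSectionNear s p →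
        Nil.IsSectionNear (fun q => σ q (s q)) p) ∧
      (∀ (hj : j + 1 ≤ k + 1) (p : T) (a : HolGerm E (ι p)) (x : IdealStalk E ι p),
        σ p (Nil.mk E ι 1 p (a • x)) =
          (ρ.induced k.le_succ).act hj (Quo.mk E ι 1 p a) (σ p (Nil.mk E ι 1 p x))) ∧
      (∀ (p : T) (x y : IdealStalk E ι p), σ p (Nil.mk E ι 1 p x) = Nil.mk E ι (j + 1) p y →
        (y : HolGerm E (ι p)) - x ∈ IdealStalk E ι p ^ 2) := by
    intro j
    induction j with
    | zero =>
      refine fun _ => ⟨fun p => AddMonoidHom.id _, fun s p hs => hs, fun _ p a x => ?_,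
        fun p x y hxy => ?_⟩
      · exact ((ρ.induced k.le_succ).act_zero a x).symm
      · have h1 : Nil.mk E ι 1 p x = Nil.mk E ι 1 p y := hxy
        rw [eq_comm, ← sub_eq_zero, ← map_sub, Nil.mk_eq_zero_iff] at h1
        exact h1
    | succ j ih =>
      intro hj
      obtain ⟨σ, hσ, hσ', hσ''⟩ := ih (by omega)
      obtain ⟨hν₁, hν₂, hν₃⟩ := hν (j + 1) hj
      refine ⟨fun p => (ν (j + 1) p).comp (σ p), fun s p hs => hν₁ _ p (hσ s p hs),
        fun hj' p a x => ?_, fun p x y hxy => ?_⟩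
      · exact (congrArg (ν (j + 1) p) (hσ' (by omega) p a x)).trans (hν₃ p _ _)
      · refine hσ'' p x y ?_
        rw [← hν₂ p (σ p _), ← Nil.proj_mk]
        exact congrArg (Nil.proj E ι (j + 1) p) hxy
  obtain ⟨σ, hσ, hσ', hσ''⟩ := key k le_rfl
  refine ⟨fun p u => (σ p u).toQuo, fun s p hs => Nil.isSectionNear_toQuo (hσ s p hs),
    fun p u v => ?_, fun p a x => ?_, fun p x => ?_⟩
  · beta_reduce
    rw [map_add, Nil.toQuo_add]
  · obtain ⟨b, hb⟩ := Quo.mk_surjective _ p (ρ.toHom p (Quo.mk E ι 1 p a))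
    obtain ⟨y, hy⟩ := Nil.mk_surjective _ p (σ p (Nil.mk E ι 1 p x))
    beta_reduce
    rw [hσ' le_rfl, ← hy, ρ.act_induced_mk k.le_succ le_rfl hb.symm, Nil.toQuo_mk, Nil.toQuo_mk,
      ← hb, ← map_mul]
    rfl
  · obtain ⟨y, hy⟩ := Nil.mk_surjective _ p (σ p (Nil.mk E ι 1 p x))
    beta_reduce
    rw [← hy, Nil.toQuo_mk, ← map_sub, Quo.mk_mem_nilIdeal_pow (by omega)]
    exact hσ'' p x y hy.symm

theorem Lifting.eq_zero_of_toHom_mem {k : ℕ} (ρ : Lifting E ι k) {p : T} {v : Quo E ι 1 p}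
    (hv : ρ.toHom p v ∈ Quo.nilIdeal E ι (k + 1) p) : v = 0 := by
  obtain ⟨a, ha⟩ := Quo.mk_surjective _ p (ρ.toHom p v)
  rw [← ha, Quo.mk_mem_nilIdeal (by omega), ← Quo.mk_one_eq_zero_iff, ρ.mk_one_eq ha.symm] at hv
  exact hv

theorem Lifting.toHom_mk_sub_mem {k : ℕ} (ρ : Lifting E ι k) {p : T} (a : HolGerm E (ι p)) :
    ρ.toHom p (Quo.mk E ι 1 p a) - Quo.mk E ι (k + 1) p a ∈ Quo.nilIdeal E ι (k + 1) p := by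
  obtain ⟨b, hb⟩ := Quo.mk_surjective _ p (ρ.toHom p (Quo.mk E ι 1 p a))
  rw [← hb, ← map_sub, Quo.mk_mem_nilIdeal (by omega), ← Quo.mk_one_eq_zero_iff, map_sub,
    ρ.mk_one_eq hb.symm, sub_self]

end Conormal

/-! ### Comfortably embedded submanifolds are linearizable -/

section Linearization

theorem exists_ringEquiv_of_isFrame {R σ Q Q' : Type*} [CommRing R] [CommRing Q] [CommRing Q']
    {K : Ideal Q} {K' : Ideal Q'} {n : ℕ} {Φ : MvPolynomial σ R →+* Q}
    {Φ' : MvPolynomial σ R →+* Q'} (h : IsFrame K n Φ) (h' : IsFrame K' n Φ') :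
    ∃ ψ : Q ≃+* Q', ∀ P, ψ (Φ P) = Φ' P := by
  have hker : RingHom.ker Φ = RingHom.ker Φ' := by
    ext P
    rw [RingHom.mem_ker, RingHom.mem_ker, h.map_eq_zero_iff, h'.map_eq_zero_iff]
  refine ⟨(RingHom.quotientKerEquivOfSurjective h.surjective).symm.trans
    ((Ideal.quotEquivOfEq hker).trans (RingHom.quotientKerEquivOfSurjective h'.surjective)),
    fun P => ?_⟩
  have h1 : (RingHom.quotientKerEquivOfSurjective h.surjective).symm (Φ P) =
      Ideal.Quotient.mk _ P := by
    rw [RingEquiv.symm_apply_eq]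
    rfl
  rw [RingEquiv.trans_apply, h1]
  rfl

variable {E : Type*} [NormedAddCommGroup E] [NormedSpace ℂ E]
  {M : Type*} [TopologicalSpace M] [ChartedSpace E M]
  {m d : ℕ} {S : Submfd E M m d}

/-- The class in `I / I ^ 2` of the coordinate `z'_i` at the points of the chart. -/
def AdaptedChart.coordNil (φ : AdaptedChart E S.carrier m d) {p : S.carrier}
    (hp : (p : M) ∈ φ.toChart.source) (i : Fin m) : Nil E (Subtype.val : S.carrier → M) 1 p :=
  Nil.mk E (Subtype.val : S.carrier → M) 1 p ⟨φ.coordGerm hp i, by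
    rw [IdealStalk, Subtype.range_val]
    exact φ.coordGerm_mem hp i⟩

open scoped Classical in
/-- The presentation of `𝓞_M / I ^ n` by polynomials in liftings of the coordinates `z'_i`, for a ring
homomorphism `ρ` from `𝓞_S` and a lifting `κ` of `I / I ^ 2`. -/
def AdaptedChart.liftFrame {n : ℕ} (φ : AdaptedChart E S.carrier m d)
    (ρ : ∀ p, Quo E (Subtype.val : S.carrier → M) 1 p →+* Quo E (Subtype.val : S.carrier → M) n p)
    (κ : ∀ p, Nil E (Subtype.val : S.carrier → M) 1 p → Quo E (Subtype.val : S.carrier → M) n p)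
    (p : S.carrier) : MvPolynomial (Fin m) (Quo E (Subtype.val : S.carrier → M) 1 p) →+*
      Quo E (Subtype.val : S.carrier → M) n p :=
  MvPolynomial.eval₂Hom (ρ p) fun i =>
    κ p (if hp : (p : M) ∈ φ.toChart.source then φ.coordNil hp i else 0)

theorem AdaptedChart.isSectionNear_coordNil (φ : AdaptedChart E S.carrier m d) {p : S.carrier}
    (hp : (p : M) ∈ φ.toChart.source) (i : Fin m) : Nil.IsSectionNear (fun q : S.carrier =>
      open scoped Classical in
      if hq : (q : M) ∈ φ.toChart.source then φ.coordNil hq i else 0) p := by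
  refine ⟨φ.coord i, ?_⟩
  filter_upwards [continuousAt_subtype_val.eventually_mem (φ.toChart.open_source.mem_nhds hp)]
    with q hq
  refine ⟨φ.contMDiffAt_coord hq i, ?_, ?_⟩
  · rw [IdealStalk, Subtype.range_val]
    exact φ.coordGerm_mem hq i
  · rw [dif_pos hq]
    rfl

/-- The liftings of `𝓞_S` and of the conormal sheaf present `𝓞_M / I ^ (k + 2)` by polynomials, with the
same kernel as the presentations of `𝓞_N / I ^ (k + 2)`. The resulting isomorphisms for different
charts agree, since both kinds of presentations change by the same linear substitution. -/
theorem isLinearizable_of_isComfortable [IsManifold 𝓘(ℂ, E) ω M] {k : ℕ} (ρ : S.Lifting (k + 1))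
    (h : (ρ.induced k.le_succ).IsComfortable) : S.IsLinearizable (k + 1) := by
  obtain ⟨κ, hκs, hκa, hκl, hκ⟩ := exists_conormal_lift h
  let Φ := fun (φ : AdaptedChart E S.carrier m d) (p : S.carrier) => φ.liftFrame ρ.toHom κ p
  let Φ' := fun (φ : AdaptedChart E S.carrier m d) (p : S.carrier) => φ.normalFrame (k + 2) p
  have hξ : ∀ (φ : AdaptedChart E S.carrier m d) {p : S.carrier} (hp : (p : M) ∈ φ.toChart.source),
      Φ φ p = MvPolynomial.eval₂Hom (ρ.toHom p) fun i => κ p (φ.coordNil hp i) := by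
    intro φ p hp
    simp only [Φ, AdaptedChart.liftFrame, dif_pos hp]
  have hΦ : ∀ (φ : AdaptedChart E S.carrier m d) (p : S.carrier), (p : M) ∈ φ.toChart.source →
      IsFrame (Quo.nilIdeal E (Subtype.val : S.carrier → M) (k + 2) p) (k + 2) (Φ φ p) := by
    intro φ p hp
    rw [hξ φ hp]
    exact φ.isFrame_eval₂Hom Subtype.range_val hp (fun _ => ρ.eq_zero_of_toHom_mem)
      (fun a => ⟨_, ρ.toHom_mk_sub_mem a⟩) fun i => hκ p _
  have hΦ' : ∀ (φ : AdaptedChart E S.carrier m d) (p : S.carrier), (p : M) ∈ φ.toChart.source →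
      IsFrame (Quo.nilIdeal (Model m d) (zeroSection S) (k + 2) p) (k + 2) (Φ' φ p) :=
    fun φ p hp => φ.isFrame_normalFrame (by omega) hp
  have hΦs : ∀ (φ : AdaptedChart E S.carrier m d) (p : S.carrier), (p : M) ∈ φ.toChart.source →
      ∀ P, IsPolySectionNear P p → Quo.IsSectionNear (fun q => Φ φ q (P q)) p :=
    fun φ p hp P hP => hP.eval₂Hom (fun s hs => ρ.map_section s p hs)
      (ξ := fun i q => κ q (open scoped Classical in
        if hq : (q : M) ∈ φ.toChart.source then φ.coordNil hq i else 0))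
      fun i => hκs _ p (φ.isSectionNear_coordNil hp i)
  have hψ : ∀ p : S.carrier, ∃ ψ : Quo (Model m d) (zeroSection S) (k + 2) p ≃+*
      Quo E (Subtype.val : S.carrier → M) (k + 2) p,
      ∀ φ : AdaptedChart E S.carrier m d, (p : M) ∈ φ.toChart.source →
        ∀ P, ψ (Φ' φ p P) = Φ φ p P := by
    intro p
    obtain ⟨φ, hφ⟩ := exists_adaptedChart S p
    obtain ⟨ψ, hψ⟩ := exists_ringEquiv_of_isFrame (hΦ' φ p hφ) (hΦ φ p hφ)
    refine ⟨ψ, fun φ' hφ' P => ?_⟩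
    obtain ⟨a, ha, ha'⟩ := φ.exists_normalFrame_eq φ' (k + 2) hφ hφ'
    have h1 : Φ φ' p = (Φ φ p).comp
        (linSubst fun i j => Quo.mk E (Subtype.val : S.carrier → M) 1 p (a i j)) := by
      rw [hξ φ hφ, hξ φ' hφ']
      refine eval₂Hom_comp_linSubst _ _ _ _ fun i => ?_
      let κ₀ : Nil E (Subtype.val : S.carrier → M) 1 p →+
        Quo E (Subtype.val : S.carrier → M) (k + 2) p := AddMonoidHom.mk' (κ p) (hκa p)
      have h2 : φ'.coordNil hφ' i = ∑ j, Nil.mk E (Subtype.val : S.carrier → M) 1 p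
          (a i j • ⟨φ.coordGerm hφ j, by
            rw [IdealStalk, Subtype.range_val]
            exact φ.coordGerm_mem hφ j⟩) := by
        rw [← map_sum]
        refine congrArg (Nil.mk E (Subtype.val : S.carrier → M) 1 p) (Subtype.ext ?_)
        rw [AddSubmonoidClass.coe_finsetSum]
        exact ha i
      rw [h2]
      refine (map_sum κ₀ _ _).trans (Finset.sum_congr rfl fun j _ => ?_)
      exact hκl p _ _
    change ψ (φ'.normalFrame (k + 2) p P) = _
    rw [ha', h1]
    exact hψ _
  choose ψ hψ using hψ
  refine ⟨ψ, fun s p hs => ?_, fun s p hs => ?_, fun p a f' f ha hf => ?_⟩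
  · obtain ⟨φ, hφ⟩ := exists_adaptedChart S p
    obtain ⟨P₀, hP₀⟩ := (hΦ' φ p hφ).surjective (s p)
    obtain ⟨P, rfl, hP, -⟩ := exists_isPolySectionNear continuous_subtype_val P₀
    have h1 := hs.eventually_eq continuous_zeroSection (φ.isSectionNear_normalFrame hφ hP) hP₀.symm
    refine (hΦs φ p hφ P hP).congr ?_
    filter_upwards [h1, continuousAt_subtype_val.eventually_mem
      (φ.toChart.open_source.mem_nhds hφ)] with q hq hφq
    rw [hq, ← hψ q φ hφq]
  · obtain ⟨φ, hφ⟩ := exists_adaptedChart S p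
    obtain ⟨P₀, hP₀⟩ := (hΦ φ p hφ).surjective (s p)
    obtain ⟨P, rfl, hP, -⟩ := exists_isPolySectionNear continuous_subtype_val P₀
    have h1 := hs.eventually_eq continuous_subtype_val (hΦs φ p hφ P hP) hP₀.symm
    refine (φ.isSectionNear_normalFrame hφ hP).congr ?_
    filter_upwards [h1, continuousAt_subtype_val.eventually_mem
      (φ.toChart.open_source.mem_nhds hφ)] with q hq hφq
    rw [hq, RingEquiv.eq_symm_apply]
    exact hψ q φ hφq _
  · obtain ⟨φ, hφ⟩ := exists_adaptedChart S p
    obtain ⟨P, rfl⟩ := (hΦ' φ p hφ).surjective a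
    obtain ⟨g, hg, hgP⟩ := (P.coeff 0).exists_isClass
    have hlow : ∀ α : Fin m →₀ ℕ, α.degree < 1 → (P - MvPolynomial.C (P.coeff 0)).coeff α = 0 := by
      intro α hα
      have hα0 : α = 0 := by rwa [Nat.lt_one_iff, Finsupp.degree_eq_zero_iff] at hα
      rw [hα0, MvPolynomial.coeff_sub, MvPolynomial.coeff_zero_C, sub_self]
    have h1 := ((hΦ' φ p hφ).mem_pow_iff 1 (by omega) _).2 hlow
    have h2 := ((hΦ φ p hφ).mem_pow_iff 1 (by omega) _).2 hlow
    have hC' : Φ' φ p (MvPolynomial.C (P.coeff 0)) = pullback S (k + 2) p (P.coeff 0) :=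
      MvPolynomial.eval₂Hom_C _ _ _
    have hC : Φ φ p (MvPolynomial.C (P.coeff 0)) = ρ.toHom p (P.coeff 0) :=
      MvPolynomial.eval₂Hom_C _ _ _
    -- both `a` and `ψ p a` restrict to the constant coefficient of `P` on the submanifold
    obtain ⟨hf₀', hf₁'⟩ := ha
    obtain ⟨hf₀, hf₁⟩ := hf
    rw [hψ p φ hφ] at hf₁
    rw [pow_one, map_sub, hC', hf₁', hgP, pullback_mk, bundleComap_germAt, ← map_sub,
      Quo.mk_mem_nilIdeal (by omega), ← germAt_sub hf₀' (contMDiffAt_comp_basePoint hg),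
      germAt_mem_idealStalk_iff isInducing_zeroSection] at h1
    have h3 := ρ.toHom_mk_sub_mem (p := p) (germAt g hg)
    rw [pow_one, map_sub, hC, hf₁, hgP] at h2
    have h4 := add_mem h2 h3
    rw [sub_add_sub_cancel, ← map_sub, Quo.mk_mem_nilIdeal (by omega), ← germAt_sub hf₀ hg,
      germAt_mem_idealStalk_iff Topology.IsInducing.subtypeVal] at h4
    filter_upwards [h1, h4] with q h5 h6
    exact (sub_eq_zero.1 h5).trans (sub_eq_zero.1 h6).symm

end Linearization

end CplxSub

end

theorem theorem4p1 {E : Type*} [NormedAddCommGroup E] [NormedSpace ℂ E] [FiniteDimensional ℂ E]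
    {M : Type*} [TopologicalSpace M] [ChartedSpace E M] [IsManifold 𝓘(ℂ, E) ω M]
    {m d : ℕ} (S : CplxSub.Submfd E M m d) (k : ℕ) (hk : 2 ≤ k) :
    S.IsLinearizable k ↔
      ∃ ρ : S.Lifting k, (ρ.induced (Nat.sub_le k 1)).IsComfortable := by
  obtain ⟨k, rfl⟩ : ∃ k', k = k' + 1 := ⟨k - 1, by omega⟩
  exact ⟨CplxSub.exists_isComfortable_of_isLinearizable,
    fun ⟨ρ, hρ⟩ => CplxSub.isLinearizable_of_isComfortable ρ hρ⟩
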